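/- Notation. Write $\mathbb R_{\max}=\mathbb R\cup\{-\infty\}$ with $a\oplus b=\max(a,b)$, $a\otimes b=a+b$, and use the corresponding matrix-matrix and matrix-vector products. Let $\mathbb{PR}^k$ be the quotient of $\mathbb R^k$ by the relation $u\simeq v\iff u=a+v$ for some $a\in\mathbb R$, let $\pi:\mathbb R^k\to\mathbb{PR}^k$ be the projection, and equip $\mathbb{PR}^k$ with the metric $d(\pi u,\pi v)=\max_i(u_i-v_i)+\max_i(v_i-u_i)$. Let $(\Omega,\mathcal F,P)$ be a probability space with a bimeasurable bijection $\theta$ preserving $P$ and ergodic. Let $A(n)$, $n\in\mathbb N$, be random $k\times k$ matrices over $\mathbb R_{\max}$ with $A(n+1)=A(n)\circ\theta$, such that almost surely every row of $A(0)$ has an entry $\neq-\infty$ (for $k\ge2$ this holds if $A(0)$ is a.s. irreducible). For $x_0\in\mathbb R^k$ let $x(0)=x_0$, $x(n+1)=A(n)\otimes x(n)$. Definitions. A deterministic matrix $C$ is a *pattern* of $\{A(n)\}$ if there is $N\ge1$ such that for every $\eta>0$, with positive probability, $M=A(N-1)\otimes\cdots\otimes A(0)$ satisfies, for all $i,j$: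 $|M_{ij}-C_{ij}|<\eta$ if $C_{ij}\in\mathbb R$, and $M_{ij}=-\infty$ if $C_{ij}=-\infty$. The graph of $C$ has an arc $i\to j$ iff $C_{ji}\ne-\infty$; its critical graph consists of the nodes and arcs of the circuits of maximal average weight. $C$ is *scs1-cyc1* if it is irreducible (for all $i,j$ there is $n\ge0$ with $(C^{\otimes n})_{ij}>-\infty$), its critical graph has exactly one maximal strongly connected subgraph, and the gcd of the lengths of the circuits of the critical graph is $1$. $C$ is *of rank 1* if there is a column $C_{\cdot j}$ such that every other column is of the form $a\otimes(\alpha\otimes C_{\cdot j})$ with $a\in\mathbb R$, $\alpha\in\mathbb R_{\max}$. A *stationary regime* of $\pi(x(n))$ is a sequence $\{Z\circ\theta^n\}$ with $Z:\Omega\to\mathbb{PR}^k$ measurable and $Z\circ\theta=\pi(A(0)\otimes\pi^{-1}(Z))$ a.s. A *stationary distribution* of the recursion is a probability measure on $\Omega\times\mathbb{PR}^k$ with $\Omega$-marginal $P$ that is invariant under $(\omega,z)\mapsto(\theta\omega,\pi(A(0,\omega)\otimes\pi^{-1}(z)))$. Two sequences $\{X_n\},\{Y_n\}$ in a metric space *$\eta$-couple*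 if for each $\eta>0$ there are versions of the two sequences (equal to them in law) on a common probability space and an a.s. finite random time $N$ such that $n\ge N\Rightarrow d(X_n,Y_n)\le\eta$. Theorem. Suppose that there is a pattern $C$ of $\{A(n)\}$ such that either the $A(n)$ are i.i.d. and $C$ is scs1-cyc1, or $C$ is of rank 1. Then $\pi(x(n))$ has a stationary regime $\{Z\circ\theta^n\}$; it is unique, i.e. any other stationary regime $\{Z'\circ\theta^n\}$ has $Z'=Z$ a.s.; the law of $(\omega,Z(\omega))$ is the unique stationary distribution; and for every $x_0\in\mathbb R^k$, the sequences $\{\pi(x(n))\}$ and $\{Z\circ\theta^n\}$ $\eta$-couple, and $\pi(x(n))$ converges weakly to the law of $Z$. -/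

import Mathlib

open MeasureTheory ProbabilityTheory Filter Topology

universe u

noncomputable section

namespace MaxPlus

/-! ### The (max,+) semiring, vectors and matrices -/

/-- The set `ℝ ∪ {-∞}`; `⊥` is `-∞`, the order gives `⊕ = max`, and `+` (with `⊥` absorbing)
is `⊗`. -/
abbrev Rmax : Type := WithBot ℝ

/-- The Borel σ-algebra of `ℝ ∪ {-∞}`: a set is measurable iff its trace on `ℝ` is Borel. -/
instance instMeasurableSpaceRmax : MeasurableSpace Rmax :=
  MeasurableSpace.map (fun r : ℝ => (r : Rmax)) inferInstance

/-- `k × k` matrices with entries in `ℝ ∪ {-∞}`. -/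
abbrev Mat (k : ℕ) : Type := Fin k → Fin k → Rmax

variable {k : ℕ}

/-- `(A ⊗ B)ᵢⱼ = max_l (Aᵢₗ + Bₗⱼ)`. -/
def mul (A B : Mat k) : Mat k :=
  fun i j => Finset.univ.sup fun l => A i l + B l j

/-- The identity: `0` on the diagonal, `-∞` elsewhere. -/
def one : Mat k := fun i j => if i = j then 0 else ⊥

/-- The power `A^{⊗ n}`. -/
def pow (A : Mat k) : ℕ → Mat k
  | 0 => one
  | n + 1 => mul A (pow A n)

/-- `(A ⊗ x)ᵢ = max_j (Aᵢⱼ + xⱼ)`. -/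
def mulVec (A : Mat k) (x : Fin k → Rmax) : Fin k → Rmax :=
  fun i => Finset.univ.sup fun j => A i j + x j

/-- A vector of `ℝ^k` seen as a vector with entries in `ℝ ∪ {-∞}`. -/
def toRmax (u : Fin k → ℝ) : Fin k → Rmax := fun i => (u i : Rmax)

/-- `u = a ⊗ v` for a real number `a`. -/
def Parallel (u v : Fin k → Rmax) : Prop := ∃ a : ℝ, ∀ i, u i = (a : Rmax) + v i

/-- `A` is irreducible: for all `i, j` there is `n ≥ 0` with `(A^n)ᵢⱼ > -∞`. -/
def IsIrreducible (A : Mat k) : Prop := ∀ i j, ∃ n : ℕ, ⊥ < pow A n i j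

/-- `A` has rank `r`: there is a set `J` of `r` pairwise non-parallel columns such that every other
column is parallel to a (max,+) linear combination of the columns in `J`. -/
def HasRank (A : Mat k) (r : ℕ) : Prop :=
  ∃ J : Finset (Fin k), J.card = r ∧
    (∀ i ∈ J, ∀ j ∈ J, i ≠ j → ¬ Parallel (fun m => A m i) (fun m => A m j)) ∧
    ∀ i ∉ J, ∃ α : Fin k → Rmax,
      Parallel (fun m => A m i) (fun m => J.sup fun j => α j + A m j)

/-! ### Graphs, critical graph, scs1-cyc1 matrices -/

/-- A circuit of length `n ≥ 1` of the directed graph with arcs `R` : a closed path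
`t 0, t 1, …, t n = t 0`. -/
structure IsCircuit (R : Fin k → Fin k → Prop) (n : ℕ) (t : Fin (n + 1) → Fin k) : Prop where
  pos : 1 ≤ n
  closed : t 0 = t (Fin.last n)
  arc : ∀ m : Fin n, R (t m.castSucc) (t m.succ)

/-- The graph of `A`: there is an arc from `i` to `j` iff `Aⱼᵢ ≠ -∞`. -/
def graph (A : Mat k) (i j : Fin k) : Prop := A j i ≠ ⊥

/-- The average weight of a path of length `n` (the entries of `A` are real along a circuit of its
graph). -/
def avgWeight (A : Mat k) (n : ℕ) (t : Fin (n + 1) → Fin k) : ℝ :=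
  (∑ m : Fin n, (A (t m.succ) (t m.castSucc)).unbotD 0) / n

/-- A circuit of the graph of `A` is critical if its average weight is maximal. -/
def IsCritical (A : Mat k) (n : ℕ) (t : Fin (n + 1) → Fin k) : Prop :=
  IsCircuit (graph A) n t ∧
    ∀ (n' : ℕ) (t' : Fin (n' + 1) → Fin k), IsCircuit (graph A) n' t' →
      avgWeight A n' t' ≤ avgWeight A n t

/-- The nodes of the critical graph: those of the critical circuits. -/
def criticalNode (A : Mat k) (i : Fin k) : Prop :=
  ∃ (n : ℕ) (t : Fin (n + 1) → Fin k), IsCritical A n t ∧ ∃ m, t m = i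

/-- The arcs of the critical graph: those of the critical circuits. -/
def criticalArc (A : Mat k) (i j : Fin k) : Prop :=
  ∃ (n : ℕ) (t : Fin (n + 1) → Fin k), IsCritical A n t ∧
    ∃ m : Fin n, t m.castSucc = i ∧ t m.succ = j

/-- The critical graph has exactly one maximal strongly connected subgraph: it is non-empty, and
any two of its nodes are joined by a path in it (each of its arcs lies on a circuit in it, so its
strongly connected components are not joined by arcs). -/
def HasUniqueSCS (A : Mat k) : Prop :=
  (∃ i, criticalNode A i) ∧
    ∀ i j, criticalNode A i → criticalNode A j → Relation.ReflTransGen (criticalArc A) i j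

/-- The strongly connected graph with arcs `R` has cyclicity `d`: `d` is the greatest common
divisor of the lengths of all its circuits. -/
def HasCyclicity (R : Fin k → Fin k → Prop) (d : ℕ) : Prop :=
  (∀ (n : ℕ) (t : Fin (n + 1) → Fin k), IsCircuit R n t → d ∣ n) ∧
    ∀ e : ℕ, (∀ (n : ℕ) (t : Fin (n + 1) → Fin k), IsCircuit R n t → e ∣ n) → e ∣ d

/-- `A` is scs1-cyc1: it is irreducible and its critical graph has a unique strongly connected
component and cyclicity one. -/
structure IsScs1Cyc1 (A : Mat k) : Prop where
  irreducible : IsIrreducible A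
  scs1 : HasUniqueSCS A
  cyc1 : HasCyclicity (criticalArc A) 1

/-! ### The projective space -/

/-- Two vectors of `ℝ^k` are parallel if they differ by a constant. -/
def parSetoid (k : ℕ) : Setoid (Fin k → ℝ) where
  r u v := ∃ a : ℝ, ∀ i, u i = a + v i
  iseqv :=
    { refl := fun _ => ⟨0, fun _ => by ring⟩
      symm := fun ⟨a, h⟩ => ⟨-a, fun i => by rw [h i]; ring⟩
      trans := fun ⟨a, h⟩ ⟨b, h'⟩ => ⟨a + b, fun i => by rw [h i, h' i]; ring⟩ }

/-- The projective space: the quotient of `ℝ^k` by parallelism. -/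
def PR (k : ℕ) : Type := Quotient (parSetoid k)

/-- The canonical projection of `ℝ^k` onto the projective space. -/
def proj (u : Fin k → ℝ) : PR k := Quotient.mk (parSetoid k) u

/-- `d(u, v) = max_i (uᵢ - vᵢ) + max_i (vᵢ - uᵢ)`. -/
def projDist (u v : Fin k → ℝ) : ℝ := (⨆ i, (u i - v i)) + ⨆ i, (v i - u i)

theorem iSup_const_add (a : ℝ) (f : Fin k → ℝ) (hk : 0 < k) :
    (⨆ i, (a + f i)) = a + ⨆ i, f i := by
  have : Nonempty (Fin k) := ⟨⟨0, hk⟩⟩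
  exact ((OrderIso.addLeft a).map_ciSup (Set.finite_range f).bddAbove).symm

theorem projDist_congr {u u' v v' : Fin k → ℝ} (h : (parSetoid k).r u u')
    (h' : (parSetoid k).r v v') : projDist u v = projDist u' v' := by
  obtain ⟨a, ha⟩ := h
  obtain ⟨b, hb⟩ := h'
  rcases Nat.eq_zero_or_pos k with rfl | hk
  · simp [projDist]
  · have e1 : (fun i => u i - v i) = fun i => (a - b) + (u' i - v' i) := by
      funext i; rw [ha, hb]; ring
    have e2 : (fun i => v i - u i) = fun i => (b - a) + (v' i - u' i) := by
      funext i; rw [ha, hb]; ring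
    unfold projDist
    rw [e1, e2, iSup_const_add _ _ hk, iSup_const_add _ _ hk]
    ring

theorem le_iSup_fin (f : Fin k → ℝ) (i : Fin k) : f i ≤ ⨆ j, f j :=
  le_ciSup (Set.finite_range f).bddAbove i

theorem projDist_triangle (u v w : Fin k → ℝ) :
    projDist u w ≤ projDist u v + projDist v w := by
  rcases Nat.eq_zero_or_pos k with rfl | hk
  · simp [projDist]
  · have : Nonempty (Fin k) := ⟨⟨0, hk⟩⟩
    have h1 : (⨆ i, (u i - w i)) ≤ (⨆ i, (u i - v i)) + ⨆ i, (v i - w i) :=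
      ciSup_le fun i => by
        have := le_iSup_fin (fun i => u i - v i) i
        have := le_iSup_fin (fun i => v i - w i) i
        linarith
    have h2 : (⨆ i, (w i - u i)) ≤ (⨆ i, (w i - v i)) + ⨆ i, (v i - u i) :=
      ciSup_le fun i => by
        have := le_iSup_fin (fun i => w i - v i) i
        have := le_iSup_fin (fun i => v i - u i) i
        linarith
    unfold projDist
    linarith

theorem rel_of_projDist_eq_zero {u v : Fin k → ℝ} (h : projDist u v = 0) :
    (parSetoid k).r u v := by
  refine ⟨⨆ i, (u i - v i), fun i => ?_⟩
  have h1 := le_iSup_fin (fun i => u i - v i) i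
  have h2 := le_iSup_fin (fun i => v i - u i) i
  unfold projDist at h

  linarith

/-- The projective distance makes `PR k` a metric space. -/
instance instMetricSpacePR : MetricSpace (PR k) where
  dist x y := Quotient.lift₂ (s₁ := parSetoid k) (s₂ := parSetoid k) projDist
    (fun _ _ _ _ h h' => projDist_congr h h') x y
  dist_self x := by
    induction x using Quotient.inductionOn with
    | h u => change projDist u u = 0; simp [projDist]
  dist_comm x y := by
    induction x using Quotient.inductionOn with
    | h u => induction y using Quotient.inductionOn with
      | h v => change projDist u v = projDist v u; exact add_comm _ _
  dist_triangle x y z := by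
    induction x using Quotient.inductionOn with
    | h u => induction y using Quotient.inductionOn with
      | h v => induction z using Quotient.inductionOn with
        | h w => exact projDist_triangle u v w
  eq_of_dist_eq_zero {x y} := by
    induction x using Quotient.inductionOn with
    | h u => induction y using Quotient.inductionOn with
      | h v => exact fun h => Quotient.sound (rel_of_projDist_eq_zero h)

instance instMeasurableSpacePR : MeasurableSpace (PR k) := borel _

instance instBorelSpacePR : BorelSpace (PR k) := ⟨rfl⟩

/-- The canonical projection, on vectors with entries in `ℝ ∪ {-∞}`. It is only meaningful for
vectors without entry `-∞`; elsewhere it takes a dummy value. -/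
def projR (x : Fin k → Rmax) : PR k := proj fun i => (x i).unbotD 0

/-- `z ↦ π(A ⊗ π⁻¹(z))`. If every row of `A` has an entry in `ℝ`, the vector `A ⊗ u` is real for
every `u ∈ ℝ^k` and its class depends on the class of `u` only. -/
def act (A : Mat k) (z : PR k) : PR k := projR (mulVec A (toRmax (Quotient.out z)))

/-! ### The stochastic recursive sequence -/

/-- The product `A(n-1) ⊗ ⋯ ⊗ A(0)`. -/
def prodMat {Ω : Type u} (A : ℕ → Ω → Mat k) (ω : Ω) : ℕ → Mat k
  | 0 => one
  | n + 1 => mul (A n ω) (prodMat A ω n)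

/-- The solution of `x(n+1) = A(n) ⊗ x(n)`, `x(0) = x₀`. -/
def sol {Ω : Type u} (A : ℕ → Ω → Mat k) (x₀ : Fin k → ℝ) : ℕ → Ω → Fin k → Rmax
  | 0, _ => toRmax x₀
  | n + 1, ω => mulVec (A n ω) (sol A x₀ n ω)

/-- The open ball of centre `M` and radius `η` for the supremum distance, in which an entry
`-∞` is at infinite distance from every real number. -/
def ball (M : Mat k) (η : ℝ) : Set (Mat k) :=
  {N | ∀ i j, (M i j = ⊥ ∧ N i j = ⊥) ∨
    ∃ a b : ℝ, M i j = (a : Rmax) ∧ N i j = (b : Rmax) ∧ |b - a| < η}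

/-- `C` is a pattern of the sequence `A(n)`: it lies in the support of a finite product
`A(N-1) ⊗ ⋯ ⊗ A(0)`. -/
def IsPattern {Ω : Type u} [MeasurableSpace Ω] (P : Measure Ω) (A : ℕ → Ω → Mat k)
    (C : Mat k) : Prop :=
  ∃ N : ℕ, 1 ≤ N ∧ ∀ η : ℝ, 0 < η → 0 < P {ω | prodMat A ω N ∈ ball C η}

/-- `Z` is (the time-zero variable of) a stationary regime of `π(x(n))`:
`Z ∘ θ = π(A(0) ⊗ π⁻¹(Z))` almost surely. -/
def IsStationaryRegime {Ω : Type u} [MeasurableSpace Ω] (P : Measure Ω) (θ : Ω → Ω)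
    (A : ℕ → Ω → Mat k) (Z : Ω → PR k) : Prop :=
  Measurable Z ∧ ∀ᵐ ω ∂P, Z (θ ω) = act (A 0 ω) (Z ω)

/-- A stationary distribution of the stochastic recursive sequence `π(x(n))`: a probability measure
on `Ω × PR k` with first marginal `P`, invariant under `(ω, z) ↦ (θ ω, π(A(0, ω) ⊗ π⁻¹(z)))`. -/
def IsStationaryDistribution {Ω : Type u} [MeasurableSpace Ω] (P : Measure Ω) (θ : Ω → Ω)
    (A : ℕ → Ω → Mat k) (Q : Measure (Ω × PR k)) : Prop :=
  Q.map Prod.fst = P ∧ Q.map (fun p => (θ p.1, act (A 0 p.1) p.2)) = Q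

/-- `η`-coupling of two sequences of random variables with values in a metric space: for each
`η > 0` there are versions of the two sequences (with the same laws as sequences) on a common
probability space and a finite random time from which on they are within distance `η`. -/
def EtaCoupling {E : Type*} [MetricSpace E] [MeasurableSpace E]
    {Ω Ω' : Type u} [MeasurableSpace Ω] [MeasurableSpace Ω'] (P : Measure Ω) (P' : Measure Ω')
    (X : ℕ → Ω → E) (Y : ℕ → Ω' → E) : Prop :=
  ∀ η : ℝ, 0 < η → ∃ (S : Type u) (_ : MeasurableSpace S) (ρ : Measure S) (X' Y' : ℕ → S → E)
    (N : S → ℕ), IsProbabilityMeasure ρ ∧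
      IdentDistrib (fun s n => X' n s) (fun ω n => X n ω) ρ P ∧
      IdentDistrib (fun s n => Y' n s) (fun ω n => Y n ω) ρ P' ∧
      Measurable N ∧ ∀ᵐ s ∂ρ, ∀ n, N s ≤ n → dist (X' n s) (Y' n s) ≤ η

end MaxPlus

end

namespace MaxPlus

variable {k : ℕ}

/-! A row-regular matrix with entries `w i + α j` (`IsOuter`) sends all of ℝ^k to a single
projective point, and no row-regular matrix increases the projective distance. A product close to
such a matrix therefore has an image of small diameter (`dist_secAct_le_of_mem_ball`). A pattern of
rank 1 already has this form. For an scs1-cyc1 pattern some power has it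
(`IsScs1Cyc1.exists_isOuter_pow`), and independence makes powers of a pattern occur in the products
too (`pow_mem_support`). In both cases, for every η some fixed number of steps shrinks the whole
space to diameter at most η with positive probability.

By ergodicity almost every orbit meets this event, in the future and in the past, and the other
factors do not undo the contraction. Hence all trajectories merge
(`ae_forall_exists_dist_cocycle_le`), and the recursion started at time -n and observed at time 0 is
Cauchy in n (`ae_forall_exists_dist_pullback_le`). Its limit `Z` is the stationary regime
(`exists_tendsto_pullback`). Merging with `Z` gives the coupling and forces every invariant measure
onto the graph of `Z` (`invariant_eq_map_graph`), hence uniqueness. The forward and backward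
iterates have the same law at each n, hence weak convergence. -/

/-! ### Algebra of (max,+) matrices. -/

theorem le_mul (A B : Mat k) (i l j : Fin k) : A i l + B l j ≤ mul A B i j :=
  Finset.le_sup (f := fun l => A i l + B l j) (Finset.mem_univ l)

theorem mul_le {A B : Mat k} {i j : Fin k} {c : Rmax} (h : ∀ l, A i l + B l j ≤ c) :
    mul A B i j ≤ c :=
  Finset.sup_le fun l _ => h l

theorem exists_mul_eq (A B : Mat k) (i j : Fin k) : ∃ l, mul A B i j = A i l + B l j := by
  obtain ⟨l, -, h⟩ := Finset.exists_mem_eq_sup (Finset.univ : Finset (Fin k)) ⟨i, Finset.mem_univ i⟩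
    fun l => A i l + B l j
  exact ⟨l, h⟩

theorem le_mulVec (A : Mat k) (x : Fin k → Rmax) (i j : Fin k) : A i j + x j ≤ mulVec A x i :=
  Finset.le_sup (f := fun j => A i j + x j) (Finset.mem_univ j)

theorem mulVec_le {A : Mat k} {x : Fin k → Rmax} {i : Fin k} {c : Rmax}
    (h : ∀ j, A i j + x j ≤ c) : mulVec A x i ≤ c :=
  Finset.sup_le fun l _ => h l

theorem exists_mulVec_eq (A : Mat k) (x : Fin k → Rmax) (i : Fin k) :
    ∃ j, mulVec A x i = A i j + x j := by
  obtain ⟨l, -, h⟩ := Finset.exists_mem_eq_sup (Finset.univ : Finset (Fin k)) ⟨i, Finset.mem_univ i⟩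
    fun j => A i j + x j
  exact ⟨l, h⟩

theorem mulVec_mul (A B : Mat k) (x : Fin k → Rmax) :
    mulVec (mul A B) x = mulVec A (mulVec B x) := by
  funext i
  apply le_antisymm
  · refine mulVec_le fun j => ?_
    obtain ⟨l, hl⟩ := exists_mul_eq A B i j
    rw [hl, add_assoc]
    exact (add_le_add le_rfl (le_mulVec B x l j)).trans (le_mulVec A _ i l)
  · refine mulVec_le fun l => ?_
    obtain ⟨j, hj⟩ := exists_mulVec_eq B x l
    rw [hj, ← add_assoc]
    exact (add_le_add (le_mul A B i l j) le_rfl).trans (le_mulVec _ x i j)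

theorem mul_assoc (A B C : Mat k) : mul (mul A B) C = mul A (mul B C) := by
  funext i j
  exact congrFun (mulVec_mul A B fun l => C l j) i

theorem one_mul (A : Mat k) : mul one A = A := by
  funext i j
  apply le_antisymm
  · refine mul_le fun l => ?_
    by_cases h : i = l
    · subst h; simp [one]
    · simp [one, h]
  · simpa [one] using le_mul one A i i j

theorem mulVec_one (x : Fin k → Rmax) : mulVec one x = x := by
  funext i
  exact congrFun (congrFun (one_mul fun l (_ : Fin k) => x l) i) i

theorem pow_add (A : Mat k) (m n : ℕ) : pow A (m + n) = mul (pow A m) (pow A n) := by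
  induction m with
  | zero => rw [Nat.zero_add]; exact (one_mul _).symm
  | succ m ih =>
    rw [Nat.add_right_comm]
    change mul A (pow A (m + n)) = mul (mul A (pow A m)) (pow A n)
    rw [ih, mul_assoc]

theorem le_pow_add (A : Mat k) (m n : ℕ) (i l j : Fin k) :
    pow A m i l + pow A n l j ≤ pow A (m + n) i j := by
  rw [pow_add]; exact le_mul _ _ i l j

theorem le_pow_succ (A : Mat k) (n : ℕ) (i l j : Fin k) :
    A i l + pow A n l j ≤ pow A (n + 1) i j := le_mul _ _ i l j

/-- Matrices whose entries are `w i + α j`: their range is a single projective point. -/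
def IsOuter (D : Mat k) : Prop := ∃ w α : Fin k → Rmax, ∀ i j, D i j = w i + α j

/-- The generating column serves as `w`, and the coefficients of the columns, possibly `-∞`, serve
as `α`. -/
theorem HasRank.isOuter {A : Mat k} (h : HasRank A 1) : IsOuter A := by
  obtain ⟨J, hJ, -, h⟩ := h
  obtain ⟨c, rfl⟩ := Finset.card_eq_one.1 hJ
  have : ∀ j, ∃ β : Rmax, ∀ i, A i j = A i c + β := by
    intro j
    by_cases hj : j = c
    · exact ⟨0, fun i => by simp [hj]⟩
    · obtain ⟨α, a, ha⟩ := h j (by simpa using hj)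
      refine ⟨a + α c, fun i => ?_⟩
      have := ha i
      simp only [Finset.sup_singleton] at this
      rw [this, add_comm (A i c), add_assoc]
  choose β hβ using this
  exact ⟨fun i => A i c, β, fun i j => hβ j i⟩

/-! ### Powers of matrices with non-positive entries. -/

theorem pow_le_zero {D : Mat k} (hD : ∀ i j, D i j ≤ 0) (n : ℕ) (i j : Fin k) :
    pow D n i j ≤ 0 := by
  induction n generalizing i with
  | zero => by_cases h : i = j <;> simp [pow, one, h]
  | succ n ih => exact mul_le fun l => add_nonpos (hD i l) (ih l)

/-- An entry of a power is the weight of a path; the partial weights are recorded. -/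
theorem exists_backtrack (D : Mat k) (n K : ℕ) (i j : Fin k) :
    ∃ s : ℕ → Fin k, s K = i ∧ ∀ a < K,
      pow D (n + a + 1) (s (a + 1)) j = D (s (a + 1)) (s a) + pow D (n + a) (s a) j := by
  induction K generalizing i with
  | zero => exact ⟨fun _ => i, rfl, by simp⟩
  | succ K ih =>
    obtain ⟨l, hl⟩ := exists_mul_eq D (pow D (n + K)) i j
    obtain ⟨s, hs, h⟩ := ih l
    refine ⟨fun a => if a = K + 1 then i else s a, by simp, fun a ha => ?_⟩
    rcases Nat.lt_succ_iff_lt_or_eq.1 ha with ha' | rfl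
    · have e1 : a ≠ K + 1 := by omega
      have e2 : a + 1 ≠ K + 1 := by omega
      simpa only [if_neg e1, if_neg e2] using h a ha'
    · have e1 : a ≠ a + 1 := by omega
      simp only [if_neg e1, if_true, hs]
      exact hl

/-- There are finitely many entries, so a path loses at least a fixed `ε` at each arc of non-zero
weight. -/
theorem exists_gap {D : Mat k} (hD : ∀ i j, D i j ≤ 0) :
    ∃ ε : ℝ, 0 < ε ∧ ∀ i j, D i j ≠ 0 → D i j ≤ ((-ε : ℝ) : Rmax) := by
  have key : ∀ p : Fin k × Fin k, ∃ ε : ℝ, 0 < ε ∧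
      (D p.1 p.2 ≠ 0 → D p.1 p.2 ≤ ((-ε : ℝ) : Rmax)) := by
    intro p
    by_cases h0 : D p.1 p.2 = 0
    · exact ⟨1, one_pos, fun h => absurd h0 h⟩
    · rcases eq_or_ne (D p.1 p.2) ⊥ with hd | hd
      · exact ⟨1, one_pos, fun _ => hd ▸ bot_le⟩
      · obtain ⟨r, hr⟩ := WithBot.ne_bot_iff_exists.1 hd
        have h := lt_of_le_of_ne (hD p.1 p.2) h0
        rw [← hr] at h
        have hr' : r < 0 := by exact_mod_cast h
        exact ⟨-r, by linarith, fun _ => by simp [← hr]⟩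
  choose f hf hf' using key
  rcases isEmpty_or_nonempty (Fin k) with he | he
  · exact ⟨1, one_pos, fun i => he.elim i⟩
  · obtain ⟨p, hp⟩ := Finite.exists_min f
    refine ⟨f p, hf p, fun i j hij => (hf' (i, j) hij).trans ?_⟩
    exact_mod_cast neg_le_neg (hp (i, j))

/-- For a matrix with non-positive entries, let `S` contain the nodes of the circuits of weight
zero. If every node is joined by a path of weight zero of any large length from any node of `S`,
then every column of the powers is eventually constant. -/
theorem exists_pow_col_const {D : Mat k} (hD : ∀ i j, D i j ≤ 0) (S : Fin k → Prop) {p₀ : ℕ}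
    (hS : ∀ c, S c → ∀ p, p₀ ≤ p → ∀ i, 0 ≤ pow D p i c)
    (hcyc : ∀ (s : ℕ → Fin k) (n : ℕ), 1 ≤ n → s 0 = s n →
      (∀ a < n, D (s (a + 1)) (s a) = 0) → S (s 0))
    {c : Fin k} (hc : S c) (j : Fin k) {q : ℕ} (hq : ⊥ < pow D q c j) :
    ∃ n v, ∀ i, pow D n i j = v := by
  obtain ⟨ε, hε, hgap⟩ := exists_gap hD
  obtain ⟨r, hr⟩ : ∃ r : ℝ, pow D q c j = r := ⟨_, (WithBot.coe_unbot _ hq.ne').symm⟩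
  have hlow : ∀ n, p₀ + q ≤ n → ∀ i, (r : Rmax) ≤ pow D n i j := by
    intro n hn i
    have h1 := le_pow_add D (n - q) q i c j
    rw [Nat.sub_add_cancel (by omega), hr] at h1
    refine le_trans ?_ h1
    simpa using add_le_add (hS c hc (n - q) (by omega) i) (le_refl (r : Rmax))
  by_contra hcon
  -- If the column never becomes constant, its upper bound falls by `ε` every `k` steps. Otherwise
  -- the last `k` arcs of a path attaining the maximum all have weight zero; by pigeonhole they
  -- contain a circuit, and its node in `S` spreads the maximum to every row.
  have step : ∀ n (m : ℝ), (∀ i, pow D n i j ≤ m) → ∀ i, pow D (n + k) i j ≤ ((m - ε : ℝ) : Rmax) := by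
    intro n m hm
    by_contra hex
    obtain ⟨i₀, hi₀⟩ := not_forall.1 hex
    have : Nonempty (Fin k) := ⟨i₀⟩
    obtain ⟨i, hi⟩ := Finite.exists_max fun i => pow D (n + k) i j
    have hi' : ¬ pow D (n + k) i j ≤ ((m - ε : ℝ) : Rmax) := fun h => hi₀ ((hi i₀).trans h)
    obtain ⟨s, hsk, hs⟩ := exists_backtrack D n k i j
    have hmono : ∀ b ≤ k, pow D (n + k) i j ≤ pow D (n + (k - b)) (s (k - b)) j := by
      intro b hb
      induction b with
      | zero => simp [hsk]
      | succ b ih =>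
        refine (ih (by omega)).trans ?_
        have h1 := hs (k - (b + 1)) (by omega)
        rw [show k - b = k - (b + 1) + 1 by omega, ← add_assoc, h1]
        simpa using add_le_add (hD (s (k - (b + 1) + 1)) (s (k - (b + 1))))
          (le_refl (pow D (n + (k - (b + 1))) (s (k - (b + 1))) j))
    have hmono' : ∀ a ≤ k, pow D (n + k) i j ≤ pow D (n + a) (s a) j := by
      intro a ha
      have := hmono (k - a) (by omega)
      rwa [Nat.sub_sub_self ha] at this
    have hup : ∀ a i, pow D (n + a) i j ≤ m := by
      intro a
      induction a with
      | zero => exact hm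
      | succ a ih =>
        exact fun i => mul_le fun l => by simpa using add_le_add (hD i l) (ih l)
    have hzero : ∀ a < k, D (s (a + 1)) (s a) = 0 := by
      intro a ha
      by_contra hne
      apply hi'
      refine (hmono' (a + 1) (by omega)).trans ?_
      rw [← add_assoc, hs a ha]
      refine (add_le_add (hgap _ _ hne) (hup a (s a))).trans ?_
      rw [← WithBot.coe_add]
      exact WithBot.coe_le_coe.2 (by linarith)
    obtain ⟨a, b, hab, hne⟩ : ∃ a b : Fin (k + 1), s a = s b ∧ a < b := by
      obtain ⟨a, b, hne, hab⟩ := Fintype.exists_ne_map_eq_of_card_lt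
        (fun a : Fin (k + 1) => s a) (by simp)
      rcases lt_or_gt_of_ne hne with h | h
      · exact ⟨a, b, hab, h⟩
      · exact ⟨b, a, hab.symm, h⟩
    have hlt : (a : ℕ) < b := hne
    have hb := b.2
    have hSa : S (s a) := by
      have := hcyc (fun t => s (a + t)) (b - a) (by omega)
        (by simp only [add_zero]; rw [Nat.add_sub_cancel' hlt.le]; exact hab)
        (fun t ht => hzero (a + t) (by omega))
      simpa using this
    -- From `s a` the path runs for `p₀ + k` more steps: at least `p₀`, so that `hS` applies, and
    -- the total is at least `n + k`, so that the non-increasing column maximum bounds it from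
    -- above.
    refine hcon ⟨p₀ + k + (n + a), pow D (n + k) i j, fun i' => le_antisymm ?_ ?_⟩
    · have hdec : ∀ t i', pow D (n + k + t) i' j ≤ pow D (n + k) i j := by
        intro t
        induction t with
        | zero => exact hi
        | succ t ih => exact fun i' => mul_le fun l => by simpa using add_le_add (hD i' l) (ih l)
      have := hdec (p₀ + a) i'
      rwa [show n + k + (p₀ + a) = p₀ + k + (n + a) by ring] at this
    · refine (hmono' a (by omega)).trans ?_
      refine le_trans ?_ (le_pow_add D (p₀ + k) (n + a) i' (s a) j)
      simpa using add_le_add (hS _ hSa (p₀ + k) (by omega) i') (le_refl (pow D (n + a) (s a) j))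
  have hall : ∀ t : ℕ, ∀ i, pow D (p₀ + q + t * k) i j ≤ ((0 - t * ε : ℝ) : Rmax) := by
    intro t
    induction t with
    | zero => intro i; simpa using pow_le_zero hD (p₀ + q) i j
    | succ t ih =>
      intro i
      have := step _ _ ih i
      rw [show p₀ + q + (t + 1) * k = p₀ + q + t * k + k by ring]
      refine this.trans (WithBot.coe_le_coe.2 (by push_cast; linarith))
  -- After this many drops of `ε` the upper bound passes below the lower bound `r`.
  obtain ⟨t, ht⟩ := exists_nat_gt (-r / ε)
  have h1 := (hlow (p₀ + q + t * k) (by omega) c).trans (hall t c)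
  have h2 : r ≤ 0 - t * ε := WithBot.coe_le_coe.1 h1
  rw [div_lt_iff₀ hε] at ht
  linarith

/-- Each row of `D` has maximum exactly `0`, so a constant column keeps its value in all later
powers; the sum of the exponents then suits all columns at once. -/
theorem isOuter_pow_of_col_const {D : Mat k} (hD : ∀ i j, D i j ≤ 0)
    (hrow : ∀ i, ∃ l, D i l = 0) (h : ∀ j, ∃ n v, ∀ i, pow D n i j = v) :
    ∃ (n : ℕ) (v : Fin k → Rmax), ∀ i j, pow D n i j = v j := by
  choose n v hv using h
  have hstay : ∀ j t i, pow D (n j + t) i j = v j := by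
    intro j t
    induction t with
    | zero => exact hv j
    | succ t ih =>
      intro i
      apply le_antisymm
      · exact mul_le fun l => by simpa [ih] using add_le_add (hD i l) (le_refl (v j))
      · obtain ⟨l, hl⟩ := hrow i
        simpa [hl, ih, add_assoc] using le_pow_succ D (n j + t) i l j
  refine ⟨∑ j, n j, v, fun i j => ?_⟩
  have hle : n j ≤ ∑ j, n j := Finset.single_le_sum (fun _ _ => Nat.zero_le _) (Finset.mem_univ j)
  simpa [Nat.add_sub_cancel' hle] using hstay j (∑ j, n j - n j) i

/-! ### Path weights, potentials and diagonal scaling. -/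

theorem exists_path_of_pow_ne_bot {D : Mat k} {n : ℕ} {i j : Fin k} (h : pow D n i j ≠ ⊥) :
    ∃ s : ℕ → Fin k, s 0 = j ∧ s n = i ∧ (∀ a < n, D (s (a + 1)) (s a) ≠ ⊥) ∧
      pow D n i j = ((∑ a ∈ Finset.range n, (D (s (a + 1)) (s a)).unbotD 0 : ℝ) : Rmax) := by
  obtain ⟨s, hsn, hs⟩ := exists_backtrack D 0 n i j
  simp only [Nat.zero_add] at hs
  -- A real total weight forces real weights on the initial segments; at length zero this makes the
  -- path start at `j`, since `one` is `-∞` off the diagonal.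
  have hne : ∀ b ≤ n, pow D (n - b) (s (n - b)) j ≠ ⊥ := by
    intro b hb
    induction b with
    | zero => simpa [hsn] using h
    | succ b ih =>
      intro hbot
      apply ih (by omega)
      rw [show n - b = n - (b + 1) + 1 by omega, hs _ (by omega), hbot, WithBot.add_bot]
  have hne' : ∀ a ≤ n, pow D a (s a) j ≠ ⊥ := by
    intro a ha
    simpa [Nat.sub_sub_self ha] using hne (n - a) (by omega)
  have h0 : s 0 = j := by
    by_contra h0
    exact hne' 0 (by omega) (by simp [pow, one, h0])
  have harc : ∀ a < n, D (s (a + 1)) (s a) ≠ ⊥ := by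
    intro a ha hbot
    apply hne' (a + 1) (by omega)
    rw [hs a ha, hbot, WithBot.bot_add]
  refine ⟨s, h0, hsn, harc, ?_⟩
  have : ∀ b ≤ n, pow D b (s b) j =
      ((∑ a ∈ Finset.range b, (D (s (a + 1)) (s a)).unbotD 0 : ℝ) : Rmax) := by
    intro b hb
    induction b with
    | zero => simp [pow, one, h0]
    | succ b ih =>
      obtain ⟨r, hr⟩ := WithBot.ne_bot_iff_exists.1 (harc b (by omega))
      rw [hs b (by omega), ih (by omega), Finset.sum_range_succ, ← hr, ← WithBot.coe_add]
      simp [add_comm]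
  simpa [hsn] using this n le_rfl

theorem pow_diag_le {C : Mat k} {l : ℝ}
    (hl : ∀ (n : ℕ) (t : Fin (n + 1) → Fin k), IsCircuit (graph C) n t → avgWeight C n t ≤ l)
    (n : ℕ) (i : Fin k) : pow C n i i ≤ ((n * l : ℝ) : Rmax) := by
  rcases Nat.eq_zero_or_pos n with rfl | hn
  · simp [pow, one]
  by_cases hb : pow C n i i = ⊥
  · simp [hb]
  obtain ⟨s, h0, hsn, harc, hsum⟩ := exists_path_of_pow_ne_bot hb
  have h := hl n (fun m => s m) ⟨hn, by simp [h0, hsn], fun m => harc m m.2⟩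
  rw [hsum, WithBot.coe_le_coe]
  rw [avgWeight, div_le_iff₀ (by exact_mod_cast hn)] at h
  rw [Finset.sum_range fun a => (C (s (a + 1)) (s a)).unbotD 0]
  simpa [mul_comm] using h

/-- The potential at `i` is the supremum of the weights of paths from `c` to `i`, with `l` deducted
per arc. It is finite because irreducibility closes such a path into a circuit at `c`. Attainment
comes only with `exists_pow_scaled_nonneg`. -/
theorem exists_potential {C : Mat k} (hC : IsIrreducible C) {l : ℝ} (c : Fin k)
    (hl : ∀ (n : ℕ), pow C n c c ≤ ((n * l : ℝ) : Rmax)) :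
    ∃ u : Fin k → ℝ, (∀ n i, pow C n i c ≤ ((u i + n * l : ℝ) : Rmax)) ∧
      ∀ i (ε : ℝ), 0 < ε → ∃ n : ℕ, ((u i + n * l - ε : ℝ) : Rmax) < pow C n i c := by
  let T : Fin k → Set ℝ := fun i => {x | ∃ (n : ℕ) (w : ℝ), pow C n i c = w ∧ x = w - n * l}
  have hne : ∀ i, (T i).Nonempty := by
    intro i
    obtain ⟨n, hn⟩ := hC i c
    obtain ⟨w, hw⟩ := WithBot.ne_bot_iff_exists.1 hn.ne'
    exact ⟨_, n, w, hw.symm, rfl⟩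
  have hbdd : ∀ i, BddAbove (T i) := by
    intro i
    obtain ⟨p, hp⟩ := hC c i
    obtain ⟨r, hr⟩ := WithBot.ne_bot_iff_exists.1 hp.ne'
    refine ⟨p * l - r, ?_⟩
    rintro x ⟨n, w, hw, rfl⟩
    have h := (le_pow_add C p n c i c).trans (hl (p + n))
    rw [← hr, hw, ← WithBot.coe_add, WithBot.coe_le_coe] at h
    push_cast at h
    linarith
  refine ⟨fun i => sSup (T i), fun n i => ?_, fun i ε hε => ?_⟩
  · by_cases hb : pow C n i c = ⊥
    · simp [hb]
    obtain ⟨w, hw⟩ := WithBot.ne_bot_iff_exists.1 hb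
    have := le_csSup (hbdd i) ⟨n, w, hw.symm, rfl⟩
    rw [← hw, WithBot.coe_le_coe]
    linarith
  · obtain ⟨x, ⟨n, w, hw, rfl⟩, hx⟩ := exists_lt_of_lt_csSup (hne i) (sub_lt_self (sSup (T i)) hε)
    refine ⟨n, ?_⟩
    rw [hw, WithBot.coe_lt_coe]
    linarith

/-- The matrix `C` scaled by the diagonal matrix `u` and divided by `l`. -/
def scaled (C : Mat k) (u : Fin k → ℝ) (l : ℝ) : Mat k :=
  fun i j => C i j + ((u j - u i - l : ℝ) : Rmax)

theorem pow_scaled (C : Mat k) (u : Fin k → ℝ) (l : ℝ) (n : ℕ) (i j : Fin k) :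
    pow (scaled C u l) n i j = pow C n i j + ((u j - u i - n * l : ℝ) : Rmax) := by
  induction n generalizing i with
  | zero => by_cases h : i = j <;> simp [pow, one, h]
  | succ n ih =>
    have key : ∀ m, scaled C u l i m + pow (scaled C u l) n m j =
        C i m + pow C n m j + ((u j - u i - (n + 1 : ℕ) * l : ℝ) : Rmax) := by
      intro m
      rw [ih, scaled, add_add_add_comm, ← WithBot.coe_add]
      congr 2
      push_cast
      ring
    apply le_antisymm
    · exact mul_le fun m => (key m).le.trans (add_le_add (le_pow_succ C n i m j) le_rfl)
    · obtain ⟨m, hm⟩ := exists_mul_eq C (pow C n) i j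
      change mul C (pow C n) i j + _ ≤ _
      rw [hm, ← key]
      exact le_pow_succ _ n i m j

theorem eq_zero_of_nonneg_add {x y : Rmax} (hx : x ≤ 0) (hy : y ≤ 0) (h : 0 ≤ x + y) : x = 0 :=
  le_antisymm hx (h.trans (by simpa using add_le_add (le_refl x) hy))

/-- Appending the arc from `j` to `i` to nearly optimal paths from `c` to `j` gives competitors in
the supremum that defines `u i`. -/
theorem scaled_nonpos {C : Mat k} {u : Fin k → ℝ} {l : ℝ} {c : Fin k}
    (h1 : ∀ n i, pow C n i c ≤ ((u i + n * l : ℝ) : Rmax))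
    (h2 : ∀ i (ε : ℝ), 0 < ε → ∃ n : ℕ, ((u i + n * l - ε : ℝ) : Rmax) < pow C n i c)
    (i j : Fin k) : scaled C u l i j ≤ 0 := by
  by_cases hb : C i j = ⊥
  · simp [scaled, hb]
  obtain ⟨r, hr⟩ := WithBot.ne_bot_iff_exists.1 hb
  rw [scaled, ← hr, ← WithBot.coe_add, ← WithBot.coe_zero, WithBot.coe_le_coe]
  refine le_of_forall_pos_le_add fun ε hε => ?_
  obtain ⟨n, hn⟩ := h2 j ε hε
  have h := ((add_le_add (le_refl (C i j)) hn.le).trans (le_pow_succ C n i j c)).trans (h1 (n + 1) i)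
  rw [← hr, ← WithBot.coe_add, WithBot.coe_le_coe] at h
  push_cast at h
  linarith

/-- The supremum is attained: if no zero-weight path led from `c` to `i`, every path from `c` to `i`
would lose at least the gap `ε`, contradicting the approximation of `u i`. -/
theorem exists_pow_scaled_nonneg {C : Mat k} {u : Fin k → ℝ} {l : ℝ} {c : Fin k}
    (h1 : ∀ n i, pow C n i c ≤ ((u i + n * l : ℝ) : Rmax))
    (h2 : ∀ i (ε : ℝ), 0 < ε → ∃ n : ℕ, ((u i + n * l - ε : ℝ) : Rmax) < pow C n i c)
    (i : Fin k) : ∃ n, 0 ≤ pow (scaled C u l) n i c := by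
  have hD := scaled_nonpos h1 h2
  obtain ⟨ε, hε, hgap⟩ := exists_gap hD
  by_contra hi
  have key : ∀ n i, (¬ ∃ n, 0 ≤ pow (scaled C u l) n i c) →
      pow (scaled C u l) n i c ≤ ((-ε : ℝ) : Rmax) := by
    intro n
    induction n with
    | zero =>
      intro i hi
      have : i ≠ c := by rintro rfl; exact hi ⟨0, by simp [pow, one]⟩
      simp [pow, one, this]
    | succ n ih =>
      intro i hi
      refine mul_le fun m => ?_
      by_cases hm : ∃ n, 0 ≤ pow (scaled C u l) n m c
      · have hne : scaled C u l i m ≠ 0 := by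
          intro h0
          obtain ⟨q, hq⟩ := hm
          refine hi ⟨q + 1, hq.trans ?_⟩
          simpa [h0] using le_pow_succ (scaled C u l) q i m c
        simpa using add_le_add (hgap i m hne) (pow_le_zero hD n m c)
      · simpa using add_le_add (hD i m) (ih m hm)
  -- The empty path at `c` competes in the supremum.
  have hu : 0 ≤ u c := by
    have := h1 0 c
    simp only [pow, one, if_true] at this
    simpa using (WithBot.coe_le_coe (a := (0 : ℝ))).1 this
  obtain ⟨n, hn⟩ := h2 i ε hε
  have h := key n i hi
  rw [pow_scaled] at h
  obtain ⟨w, hw⟩ := WithBot.ne_bot_iff_exists.1 (bot_le.trans_lt hn).ne'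
  rw [← hw, WithBot.coe_lt_coe] at hn
  rw [← hw, ← WithBot.coe_add, WithBot.coe_le_coe] at h
  linarith

/-- The potential telescopes along a critical circuit, so its scaled weight is zero; a zero sum of
non-positive terms has only zero terms. -/
theorem scaled_eq_zero_of_criticalArc {C : Mat k} {u : Fin k → ℝ} {l : ℝ}
    (hD : ∀ i j, scaled C u l i j ≤ 0)
    (hl : ∀ (n : ℕ) (t : Fin (n + 1) → Fin k), IsCritical C n t → avgWeight C n t = l)
    {i j : Fin k} (h : criticalArc C i j) : scaled C u l j i = 0 := by
  obtain ⟨n, t, hct, m, rfl, rfl⟩ := h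
  have hw := hl n t hct
  obtain ⟨⟨hpos, hclosed, harc⟩, -⟩ := hct
  have hreal : ∀ m : Fin n, scaled C u l (t m.succ) (t m.castSucc) =
      (((C (t m.succ) (t m.castSucc)).unbotD 0 + (u (t m.castSucc) - u (t m.succ) - l) : ℝ) :
        Rmax) := by
    intro m
    obtain ⟨r, hr⟩ := WithBot.ne_bot_iff_exists.1 (harc m)
    simp only [scaled, ← hr, WithBot.unbotD_coe, WithBot.coe_add]
  have hle : ∀ m : Fin n, (C (t m.succ) (t m.castSucc)).unbotD 0 +
      (u (t m.castSucc) - u (t m.succ) - l) ≤ 0 := by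
    intro m
    have := hD (t m.succ) (t m.castSucc)
    rw [hreal] at this
    exact_mod_cast this
  have htel : ∑ m : Fin n, u (t m.castSucc) = ∑ m : Fin n, u (t m.succ) := by
    have e1 := Fin.sum_univ_castSucc fun m => u (t m)
    have e2 := Fin.sum_univ_succ fun m => u (t m)
    rw [hclosed] at e2
    linarith
  have hn : (n : ℝ) ≠ 0 := by positivity
  have hsum : ∑ m : Fin n, ((C (t m.succ) (t m.castSucc)).unbotD 0 +
      (u (t m.castSucc) - u (t m.succ) - l)) = 0 := by
    rw [avgWeight, div_eq_iff hn] at hw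
    rw [Finset.sum_add_distrib, Finset.sum_sub_distrib, Finset.sum_sub_distrib, htel, hw]
    simp [mul_comm]
  have := (Finset.sum_eq_zero_iff_of_nonpos fun m _ => hle m).1 hsum m (Finset.mem_univ m)
  rw [hreal, this, WithBot.coe_zero]

/-- By telescoping, a circuit of scaled weight zero has average weight `l`, the maximal one. -/
theorem criticalNode_of_scaled_eq_zero {C : Mat k} {u : Fin k → ℝ} {l : ℝ}
    (hl : ∀ (n : ℕ) (t : Fin (n + 1) → Fin k), IsCircuit (graph C) n t → avgWeight C n t ≤ l)
    (s : ℕ → Fin k) (n : ℕ) (hn : 1 ≤ n) (hs : s 0 = s n)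
    (h : ∀ a < n, scaled C u l (s (a + 1)) (s a) = 0) : criticalNode C (s 0) := by
  have harc : ∀ a < n, C (s (a + 1)) (s a) = ((u (s (a + 1)) - u (s a) + l : ℝ) : Rmax) := by
    intro a ha
    have h0 := h a ha
    have hb : C (s (a + 1)) (s a) ≠ ⊥ := by
      intro hb; simp [scaled, hb] at h0
    obtain ⟨r, hr⟩ := WithBot.ne_bot_iff_exists.1 hb
    rw [scaled, ← hr, ← WithBot.coe_add, ← WithBot.coe_zero, WithBot.coe_inj] at h0
    rw [← hr, WithBot.coe_inj]
    linarith
  have havg : avgWeight C n (fun m => s m) = l := by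
    rw [avgWeight, div_eq_iff (by positivity)]
    have : ∀ m : Fin n, (C (s (m.succ : Fin (n + 1))) (s (m.castSucc : Fin (n + 1)))).unbotD 0 =
        (fun a => u (s (a + 1)) - u (s a) + l) (m : ℕ) := by
      intro m
      have := harc m m.2
      simp only [Fin.val_succ, Fin.val_castSucc, this, WithBot.unbotD_coe]
    rw [Finset.sum_congr rfl fun m _ => this m,
      ← Finset.sum_range fun a => u (s (a + 1)) - u (s a) + l, Finset.sum_add_distrib,
      Finset.sum_range_sub fun a => u (s a), hs]
    simp [mul_comm]
  refine ⟨n, fun m => s m, ⟨⟨hn, by simp [hs], fun m => ?_⟩, fun n' t' ht' => ?_⟩, 0, rfl⟩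
  · simp [graph, harc m m.2]
  · rw [havg]; exact hl n' t' ht'

/-! ### Powers of scs1-cyc1 matrices. -/

/-- An additive submonoid of `ℕ` whose elements have no common divisor contains all large
integers. -/
theorem exists_forall_ge_mem (S : AddSubmonoid ℕ) (h : ∀ e : ℕ, (∀ n ∈ S, e ∣ n) → e ∣ 1) :
    ∃ N, ∀ n ≥ N, n ∈ S := by
  obtain ⟨N, hN⟩ := Nat.exists_mem_closure_of_ge (S : Set ℕ)
  refine ⟨N, fun n hn => ?_⟩
  have h1 := h (Nat.setGcd (S : Set ℕ)) fun n hn => Nat.setGcd_dvd_of_mem hn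
  simpa using hN n hn (h1.trans (one_dvd n))

theorem exists_pow_nonneg_of_reflTransGen {R : Fin k → Fin k → Prop} {D : Mat k}
    (h : ∀ i j, R i j → 0 ≤ D j i) {i j : Fin k} (hij : Relation.ReflTransGen R i j) :
    ∃ n, 0 ≤ pow D n j i := by
  induction hij with
  | refl => exact ⟨0, by simp [pow, one]⟩
  | tail _ hbc ih =>
    obtain ⟨n, hn⟩ := ih
    exact ⟨n + 1, (add_nonneg (h _ _ hbc) hn).trans (le_pow_succ D n _ _ _)⟩

theorem IsCircuit.pow_nonneg {R : Fin k → Fin k → Prop} {D : Mat k}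
    (h : ∀ i j, R i j → 0 ≤ D j i) {n : ℕ} {t : Fin (n + 1) → Fin k} (ht : IsCircuit R n t) :
    0 ≤ pow D n (t 0) (t 0) := by
  have : ∀ m (hm : m < n + 1), 0 ≤ pow D m (t ⟨m, hm⟩) (t 0) := by
    intro m
    induction m with
    | zero => intro _; simp [pow, one]
    | succ m ih =>
      intro hm
      exact (add_nonneg (h _ _ (ht.arc ⟨m, by omega⟩)) (ih (by omega))).trans
        (le_pow_succ D m _ _ _)
  have h' := this n (by omega)
  change 0 ≤ pow D n (t (Fin.last n)) (t 0) at h'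
  rwa [← ht.closed] at h'

/-- After scaling, critical arcs have weight zero and all others at most zero. Connectedness and
cyclicity one of the critical graph give zero-weight paths of every large length from any critical
node to any node. Then the columns of a power are constant, and undoing the scaling turns constant
columns into the form `w i + α j`. -/
theorem IsScs1Cyc1.exists_isOuter_pow {C : Mat k} (hC : IsScs1Cyc1 C) :
    ∃ n, IsOuter (pow C n) := by
  obtain ⟨hirr, ⟨⟨c, hc⟩, hconn⟩, hcyc⟩ := hC
  obtain ⟨n₀, t₀, ht₀, -⟩ := id hc
  set l := avgWeight C n₀ t₀ with hldef
  have hl := ht₀.2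
  have hl' : ∀ (n : ℕ) (t : Fin (n + 1) → Fin k), IsCritical C n t → avgWeight C n t = l :=
    fun n t ht => le_antisymm (hl n t ht.1) (ht.2 n₀ t₀ ht₀.1)
  obtain ⟨u, h1, h2⟩ := exists_potential hirr c fun n => pow_diag_le hl n c
  have hD := scaled_nonpos h1 h2
  have hreach := exists_pow_scaled_nonneg h1 h2
  set D := scaled C u l with hDdef
  have harc : ∀ i j, criticalArc C i j → 0 ≤ D j i := fun i j h =>
    (scaled_eq_zero_of_criticalArc hD hl' h).ge
  have hpath : ∀ i j, criticalNode C i → criticalNode C j → ∃ n, 0 ≤ pow D n j i :=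
    fun i j hi hj => exists_pow_nonneg_of_reflTransGen harc (hconn i j hi hj)
  let M : AddSubmonoid ℕ :=
    { carrier := {n | 0 ≤ pow D n c c}
      zero_mem' := by simp [pow, one]
      add_mem' := fun {a b} ha hb => (add_nonneg ha hb).trans (le_pow_add D a b c c c) }
  -- A common divisor `e` of the zero-weight return lengths at `c` divides the length of every
  -- critical circuit: compare the detour from `c` to the circuit and back with the same detour
  -- going once around it.
  obtain ⟨L, hL⟩ := exists_forall_ge_mem M fun e he => hcyc.2 e fun n t ht => by
    have hnode : criticalNode C (t 0) := by
      obtain ⟨n', t', ht', m, hm, -⟩ := ht.arc ⟨0, ht.pos⟩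
      exact ⟨n', t', ht', _, hm⟩
    obtain ⟨a, ha⟩ := hpath c (t 0) hc hnode
    obtain ⟨b, hb⟩ := hpath (t 0) c hnode hc
    have e1 : e ∣ b + a := he _ ((add_nonneg hb ha).trans (le_pow_add D b a c (t 0) c))
    have e2 : e ∣ b + (n + a) := he _ ((add_nonneg hb ((add_nonneg (ht.pow_nonneg harc) ha).trans
      (le_pow_add D n a _ (t 0) c))).trans (le_pow_add D b (n + a) c (t 0) c))
    rw [show b + (n + a) = b + a + n by ring] at e2
    exact (Nat.dvd_add_right e1).1 e2
  choose q hq using hreach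
  have : ∀ c', ∃ a, criticalNode C c' → 0 ≤ pow D a c c' := by
    intro c'
    by_cases h : criticalNode C c'
    · obtain ⟨a, ha⟩ := hpath c' c h hc
      exact ⟨a, fun _ => ha⟩
    · exact ⟨0, fun h' => absurd h' h⟩
  choose a ha using this
  have hqle : ∀ i, q i ≤ ∑ i, q i := fun i =>
    Finset.single_le_sum (fun _ _ => Nat.zero_le _) (Finset.mem_univ i)
  have hale : ∀ i, a i ≤ ∑ i, a i := fun i =>
    Finset.single_le_sum (fun _ _ => Nat.zero_le _) (Finset.mem_univ i)
  have hS : ∀ c', criticalNode C c' → ∀ p, ∑ i, q i + L + ∑ i, a i ≤ p → ∀ i, 0 ≤ pow D p i c' := by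
    intro c' hc' p hp i
    have := hqle i
    have := hale c'
    -- Go from `c'` to `c`, loop at `c` for the missing length, then go from `c` to `i`.
    have hmid : 0 ≤ pow D (p - q i - a c') c c := hL (p - q i - a c') (by omega)
    have e1 := (add_nonneg hmid (ha c' hc')).trans (le_pow_add D _ _ c c c')
    have e2 := (add_nonneg (hq i) e1).trans (le_pow_add D _ _ i c c')
    rwa [show q i + (p - q i - a c' + a c') = p by omega] at e2
  have hrow : ∀ i, ∃ m, D i m = 0 := by
    intro i
    have h := hS c hc (∑ i, q i + L + ∑ i, a i + 1) (by omega) i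
    obtain ⟨m, hm⟩ := exists_mul_eq D (pow D (∑ i, q i + L + ∑ i, a i)) i c
    change 0 ≤ mul D (pow D _) i c at h
    rw [hm] at h
    exact ⟨m, eq_zero_of_nonneg_add (hD i m) (pow_le_zero hD _ m c) h⟩
  obtain ⟨n, v, hv⟩ := isOuter_pow_of_col_const hD hrow fun j => by
    obtain ⟨r, hr⟩ := hirr c j
    refine exists_pow_col_const hD (criticalNode C) hS
      (fun s n hn hs h => criticalNode_of_scaled_eq_zero hl s n hn hs h) hc j (q := r) ?_
    rw [hDdef, pow_scaled]
    obtain ⟨w, hw⟩ := WithBot.ne_bot_iff_exists.1 hr.ne'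
    rw [← hw, ← WithBot.coe_add]
    exact WithBot.bot_lt_coe _
  refine ⟨n, fun i => ((u i : ℝ) : Rmax), fun j => v j + ((n * l - u j : ℝ) : Rmax),
    fun i j => ?_⟩
  change pow C n i j = (u i : Rmax) + (v j + ((n * l - u j : ℝ) : Rmax))
  rw [← hv i j, hDdef, pow_scaled, add_assoc, add_left_comm, ← WithBot.coe_add, ← WithBot.coe_add]
  rw [show u i + (u j - u i - n * l + (n * l - u j)) = 0 by ring, WithBot.coe_zero, add_zero]

/-! ### Contracting cocycles over an ergodic automorphism -/

section Cocycle

variable {Ω E : Type*}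

/-- The composition `g (θⁿ⁻¹ ω) ∘ ⋯ ∘ g ω`. -/
def cocycle (θ : Ω → Ω) (g : Ω → E → E) : ℕ → Ω → E → E
  | 0, _, z => z
  | n + 1, ω, z => g (θ^[n] ω) (cocycle θ g n ω z)

theorem cocycle_add (θ : Ω → Ω) (g : Ω → E → E) (m n : ℕ) (ω : Ω) (z : E) :
    cocycle θ g (m + n) ω z = cocycle θ g m (θ^[n] ω) (cocycle θ g n ω z) := by
  induction m with
  | zero => simp [cocycle]
  | succ m ih =>
    rw [Nat.add_right_comm]
    simp only [cocycle]
    rw [ih, Function.iterate_add_apply]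

theorem dist_cocycle_le [PseudoMetricSpace E] {θ : Ω → Ω} {g : Ω → E → E} {ω : Ω}
    (h : ∀ n z z', dist (g (θ^[n] ω) z) (g (θ^[n] ω) z') ≤ dist z z') (n : ℕ) (z z' : E) :
    dist (cocycle θ g n ω z) (cocycle θ g n ω z') ≤ dist z z' := by
  induction n with
  | zero => exact le_rfl
  | succ n ih => exact (h n _ _).trans ih

theorem iterate_iterate_symm [MeasurableSpace Ω] (θ : Ω ≃ᵐ Ω) (m n : ℕ) (ω : Ω) :
    θ^[m] (θ.symm^[m + n] ω) = θ.symm^[n] ω := by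
  rw [Function.iterate_add_apply]
  exact (Function.LeftInverse.iterate θ.apply_symm_apply m) _

/-- The cocycle started at time `-n` and observed at time `0`. -/
def pullback [MeasurableSpace Ω] (θ : Ω ≃ᵐ Ω) (g : Ω → E → E) (n : ℕ) (ω : Ω) (z : E) : E :=
  cocycle θ g n (θ.symm^[n] ω) z

theorem pullback_add [MeasurableSpace Ω] {θ : Ω ≃ᵐ Ω} {g : Ω → E → E} (n m : ℕ) (ω : Ω) (z : E) :
    pullback θ g (n + m) ω z = pullback θ g n ω (cocycle θ g m (θ.symm^[m + n] ω) z) := by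
  unfold pullback
  rw [cocycle_add, add_comm n m, iterate_iterate_symm]

theorem pullback_succ_map [MeasurableSpace Ω] {θ : Ω ≃ᵐ Ω} {g : Ω → E → E} (n : ℕ) (ω : Ω) (z : E) :
    pullback θ g (n + 1) (θ ω) z = g ω (pullback θ g n ω z) := by
  unfold pullback
  rw [Function.iterate_succ_apply, θ.symm_apply_apply]
  change g (θ^[n] (θ.symm^[n] ω)) _ = _
  rw [show θ^[n] (θ.symm^[n] ω) = ω from iterate_iterate_symm θ n 0 ω]

variable [MeasurableSpace Ω] {P : Measure Ω}

theorem ae_iterate {f : Ω → Ω} (hf : MeasurePreserving f P P) {p : Ω → Prop}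
    (hp : ∀ᵐ ω ∂P, p ω) : ∀ᵐ ω ∂P, ∀ n, p (f^[n] ω) :=
  ae_all_iff.2 fun n => (hf.iterate n).quasiMeasurePreserving.ae hp

theorem measurable_cocycle [MeasurableSpace E] {θ : Ω → Ω} {g : Ω → E → E} (hθ : Measurable θ) (hg : Measurable (Function.uncurry g)) (n : ℕ) :
    Measurable (Function.uncurry (cocycle θ g n)) := by
  induction n with
  | zero => exact measurable_snd
  | succ n ih => exact hg.comp (((hθ.iterate n).comp measurable_fst).prodMk ih)

theorem ae_eq_cocycle {θ : Ω → Ω} {g : Ω → E → E} {Z : Ω → E} (hθ : MeasurePreserving θ P P)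
    (hZ : ∀ᵐ ω ∂P, Z (θ ω) = g ω (Z ω)) :
    ∀ᵐ ω ∂P, ∀ n, Z (θ^[n] ω) = cocycle θ g n ω (Z ω) := by
  filter_upwards [ae_iterate hθ hZ] with ω h n
  induction n with
  | zero => rfl
  | succ n ih => rw [Function.iterate_succ_apply', h n, ih]; rfl

/-- The graph map of `Z` intertwines `θ` with the skew product, so it carries `P` to an invariant
measure. -/
theorem map_graph_invariant [MeasurableSpace E] {θ : Ω → Ω} (hθ : MeasurePreserving θ P P) {h : Ω → E → E}
    {Z : Ω → E} (hZ : Measurable Z) (hZst : ∀ᵐ ω ∂P, Z (θ ω) = h ω (Z ω))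
    (hh : AEMeasurable (fun p : Ω × E => (θ p.1, h p.1 p.2)) (P.map fun ω => (ω, Z ω))) :
    (P.map fun ω => (ω, Z ω)).map (fun p => (θ p.1, h p.1 p.2)) = P.map fun ω => (ω, Z ω) := by
  have hZm : Measurable fun ω => (ω, Z ω) := measurable_id.prodMk hZ
  rw [AEMeasurable.map_map_of_aemeasurable hh hZm.aemeasurable]
  have : ((fun p : Ω × E => (θ p.1, h p.1 p.2)) ∘ fun ω => (ω, Z ω)) =ᵐ[P]
      (fun ω => (ω, Z ω)) ∘ θ := by
    filter_upwards [hZst] with ω hω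
    simp [hω]
  rw [Measure.map_congr this, ← Measure.map_map hZm hθ.measurable, hθ.map_eq]

variable [IsProbabilityMeasure P]

/-- The set of points that ever reach `S` contains its preimage, so it is null or full; it contains
`S`. -/
theorem ae_exists_iterate_mem {f : Ω → Ω} (hf : Ergodic f P) {S : Set Ω} (hS : MeasurableSet S)
    (hPS : 0 < P S) : ∀ᵐ ω ∂P, ∃ n, f^[n] ω ∈ S := by
  set U : Set Ω := {ω | ∃ n, f^[n] ω ∈ S} with hU
  have hUm : MeasurableSet U := by
    have : U = ⋃ n, (f^[n]) ⁻¹' S := by ext ω; simp [hU]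
    rw [this]
    exact MeasurableSet.iUnion fun n => (hf.toMeasurePreserving.iterate n).measurable hS
  have hsub : f ⁻¹' U ⊆ U := by
    rintro ω ⟨n, hn⟩
    exact ⟨n + 1, by rwa [Function.iterate_succ_apply]⟩
  have hSU : S ⊆ U := fun ω hω => ⟨0, hω⟩
  rcases hf.ae_empty_or_univ_of_preimage_ae_le hUm.nullMeasurableSet
    (Eventually.of_forall hsub) with h | h
  · have h0 : P U = 0 := by rw [measure_congr h, measure_empty]
    exact absurd (measure_mono_null hSU h0) hPS.ne'
  · exact (eventuallyEq_univ (s := U)).1 h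

variable [MetricSpace E] {θ : Ω ≃ᵐ Ω} {g : Ω → E → E}

/-- One visit to the contracting event brings all trajectories within η, and the later nonexpansive
maps keep them there. -/
theorem ae_forall_exists_dist_cocycle_le (hθ : Ergodic θ P)
    (hne : ∀ᵐ ω ∂P, ∀ z z', dist (g ω z) (g ω z') ≤ dist z z')
    (hcon : ∀ η : ℝ, 0 < η → ∃ (N : ℕ) (S : Set Ω), MeasurableSet S ∧ 0 < P S ∧
      ∀ᵐ ω ∂P, ω ∈ S → ∀ z z', dist (cocycle θ g N ω z) (cocycle θ g N ω z') ≤ η) :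
    ∀ᵐ ω ∂P, ∀ η : ℝ, 0 < η → ∃ n₀, ∀ n ≥ n₀, ∀ z z',
      dist (cocycle θ g n ω z) (cocycle θ g n ω z') ≤ η := by
  have key : ∀ q : ℕ, ∀ᵐ ω ∂P, ∃ n₀, ∀ n ≥ n₀, ∀ z z',
      dist (cocycle θ g n ω z) (cocycle θ g n ω z') ≤ 1 / ((q : ℝ) + 1) := by
    intro q
    obtain ⟨N, S, hS, hPS, hcon⟩ := hcon (1 / ((q : ℝ) + 1)) (by positivity)
    filter_upwards [ae_exists_iterate_mem hθ hS hPS, ae_iterate hθ.toMeasurePreserving hne,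
      ae_iterate hθ.toMeasurePreserving hcon] with ω ⟨n, hn⟩ hne hcon
    refine ⟨N + n, fun m hm z z' => ?_⟩
    obtain ⟨r, rfl⟩ := Nat.exists_eq_add_of_le' hm
    rw [cocycle_add θ g r (N + n), cocycle_add θ g r (N + n)]
    refine (dist_cocycle_le (fun s => ?_) r _ _).trans ?_
    · rw [← Function.iterate_add_apply]; exact hne _
    · rw [cocycle_add, cocycle_add]
      exact hcon n hn _ _
  filter_upwards [ae_all_iff.2 key] with ω h η hη
  obtain ⟨q, hq⟩ := exists_nat_one_div_lt hη
  obtain ⟨n₀, hn₀⟩ := h q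
  exact ⟨n₀, fun n hn z z' => (hn₀ n hn z z').trans hq.le⟩

/-- Here the contraction takes place at a visit in the past. Starting even earlier only changes the
point fed into the same small image, which gives the Cauchy property. -/
theorem ae_forall_exists_dist_pullback_le (hθ : Ergodic θ P)
    (hne : ∀ᵐ ω ∂P, ∀ z z', dist (g ω z) (g ω z') ≤ dist z z')
    (hcon : ∀ η : ℝ, 0 < η → ∃ (N : ℕ) (S : Set Ω), MeasurableSet S ∧ 0 < P S ∧
      ∀ᵐ ω ∂P, ω ∈ S → ∀ z z', dist (cocycle θ g N ω z) (cocycle θ g N ω z') ≤ η) :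
    ∀ᵐ ω ∂P, ∀ η : ℝ, 0 < η → ∃ n, ∀ m ≥ n, ∀ z z',
      dist (pullback θ g m ω z) (pullback θ g n ω z') ≤ η := by
  have hs : MeasurePreserving θ.symm P P := hθ.symm.toMeasurePreserving
  have key : ∀ q : ℕ, ∀ᵐ ω ∂P, ∃ n, ∀ m ≥ n, ∀ z z',
      dist (pullback θ g m ω z) (pullback θ g n ω z') ≤ 1 / ((q : ℝ) + 1) := by
    intro q
    obtain ⟨N, S, hS, hPS, hcon⟩ := hcon (1 / ((q : ℝ) + 1)) (by positivity)
    -- The visit is sought before time `-N`, so that the `N` contracting steps are over by time 0.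
    filter_upwards [(hs.iterate N).quasiMeasurePreserving.ae
      (ae_exists_iterate_mem hθ.symm hS hPS),
      ae_iterate hs (ae_iterate hθ.toMeasurePreserving hne),
      ae_iterate hs hcon] with ω ⟨n, hn⟩ hne hcon
    have hdiam : ∀ z z', dist (pullback θ g (n + N) ω z) (pullback θ g (n + N) ω z') ≤
        1 / ((q : ℝ) + 1) := by
      intro z z'
      unfold pullback
      rw [cocycle_add, cocycle_add]
      refine (dist_cocycle_le (fun s => ?_) n _ _).trans ?_
      · rw [add_comm n N, iterate_iterate_symm]; exact hne n s
      · refine hcon _ ?_ _ _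
        rwa [Function.iterate_add_apply]
    refine ⟨n + N, fun m hm z z' => ?_⟩
    obtain ⟨r, rfl⟩ := Nat.exists_eq_add_of_le hm
    rw [pullback_add]
    exact hdiam _ _
  filter_upwards [ae_all_iff.2 key] with ω h η hη
  obtain ⟨q, hq⟩ := exists_nat_one_div_lt hη
  obtain ⟨n₀, hn₀⟩ := h q
  exact ⟨n₀, fun n hn z z' => (hn₀ n hn z z').trans hq.le⟩

variable [MeasurableSpace E]

variable [BorelSpace E]

/-- Loynes' construction: the pullback limit of a contracting cocycle is a stationary regime. -/
theorem exists_tendsto_pullback [CompleteSpace E] [Nonempty E] (hθ : Ergodic θ P)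
    (hg : Measurable (Function.uncurry g))
    (hne : ∀ᵐ ω ∂P, ∀ z z', dist (g ω z) (g ω z') ≤ dist z z')
    (hcon : ∀ η : ℝ, 0 < η → ∃ (N : ℕ) (S : Set Ω), MeasurableSet S ∧ 0 < P S ∧
      ∀ᵐ ω ∂P, ω ∈ S → ∀ z z', dist (cocycle θ g N ω z) (cocycle θ g N ω z') ≤ η) :
    ∃ Z : Ω → E, Measurable Z ∧ (∀ᵐ ω ∂P, Z (θ ω) = g ω (Z ω)) ∧
      ∀ z, ∀ᵐ ω ∂P, Tendsto (fun n => pullback θ g n ω z) atTop (𝓝 (Z ω)) := by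
  have hpull := ae_forall_exists_dist_pullback_le hθ hne hcon
  obtain ⟨z₀⟩ := ‹Nonempty E›
  have hmeas : ∀ n, Measurable fun ω => pullback θ g n ω z₀ := fun n =>
    (measurable_cocycle θ.measurable hg n).comp
      ((θ.symm.measurable.iterate n).prodMk measurable_const)
  have hlim : ∀ᵐ ω ∂P, ∃ l, Tendsto (fun n => pullback θ g n ω z₀) atTop (𝓝 l) := by
    filter_upwards [hpull] with ω h
    refine cauchySeq_tendsto_of_complete (Metric.cauchySeq_iff'.2 fun ε hε => ?_)
    obtain ⟨n, hn⟩ := h (ε / 2) (by positivity)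
    exact ⟨n, fun m hm => (hn m hm z₀ z₀).trans_lt (by linarith)⟩
  obtain ⟨Z, hZ, hZlim⟩ := measurable_limit_of_tendsto_metrizable_ae
    (fun n => (hmeas n).aemeasurable) hlim
  refine ⟨Z, hZ, ?_, fun z => ?_⟩
  · filter_upwards [hZlim, hθ.quasiMeasurePreserving.ae hZlim, hne] with ω h1 h2 hne
    have hcont : Continuous (g ω) :=
      (LipschitzWith.of_dist_le_mul (K := 1) fun z z' => by simpa using hne z z').continuous
    -- Moving the observation time from 0 to 1 applies `g ω` to the iterates; continuity passes this
    -- to the limit.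
    refine tendsto_nhds_unique ((tendsto_add_atTop_iff_nat 1).2 h2) ?_
    simp only [pullback_succ_map]
    exact (hcont.tendsto _).comp h1
  · filter_upwards [hpull, hZlim] with ω h hlim
    refine tendsto_iff_dist_tendsto_zero.2 ?_
    have h0 : Tendsto (fun n => dist (pullback θ g n ω z) (pullback θ g n ω z₀)) atTop (𝓝 0) := by
      refine Metric.tendsto_atTop.2 fun ε hε => ?_
      obtain ⟨n, hn⟩ := h (ε / 3) (by positivity)
      refine ⟨n, fun m hm => ?_⟩
      have e1 := hn m hm z z₀
      have e2 := hn m hm z₀ z₀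
      have e3 := dist_triangle_right (pullback θ g m ω z) (pullback θ g m ω z₀)
        (pullback θ g n ω z₀)
      rw [Real.dist_0_eq_abs, abs_of_nonneg dist_nonneg]
      linarith
    have h1 := h0.add (tendsto_iff_dist_tendsto_zero.1 hlim)
    rw [add_zero] at h1
    exact squeeze_zero (fun _ => dist_nonneg) (fun n => dist_triangle _ _ _) h1

variable [SecondCountableTopology E]

/-- Invariant measures of a contracting skew product are carried by the graph of any stationary
regime. -/
theorem invariant_eq_map_graph (hθ : Ergodic θ P) (hg : Measurable (Function.uncurry g))
    (hctr : ∀ᵐ ω ∂P, ∀ η : ℝ, 0 < η → ∃ n₀, ∀ n ≥ n₀, ∀ z z',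
      dist (cocycle θ g n ω z) (cocycle θ g n ω z') ≤ η)
    {Z : Ω → E} (hZ : Measurable Z) (hZst : ∀ᵐ ω ∂P, Z (θ ω) = g ω (Z ω))
    {Q : Measure (Ω × E)} (hQ1 : Q.map Prod.fst = P)
    (hQ : Q.map (fun p => (θ p.1, g p.1 p.2)) = Q) :
    Q = P.map fun ω => (ω, Z ω) := by
  have hfin : IsFiniteMeasure Q := by
    constructor
    have h := congrArg (fun μ => μ Set.univ) hQ1
    simp only [Measure.map_apply measurable_fst MeasurableSet.univ, Set.preimage_univ,
      measure_univ] at h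
    rw [h]; exact ENNReal.one_lt_top
  set F : Ω × E → Ω × E := fun p => (θ p.1, g p.1 p.2) with hF
  have hFm : MeasurePreserving F Q Q := ⟨(θ.measurable.comp measurable_fst).prodMk hg, hQ⟩
  have hfst : MeasurePreserving (Prod.fst : Ω × E → Ω) Q P := ⟨measurable_fst, hQ1⟩
  have hFn : ∀ n p, F^[n] p = (θ^[n] p.1, cocycle θ g n p.1 p.2) := by
    intro n p
    induction n with
    | zero => rfl
    | succ n ih =>
      rw [Function.iterate_succ_apply', ih, hF, Function.iterate_succ_apply']
      rfl
  -- The integral of the truncated distance to the graph is constant along the invariant dynamics,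
  -- yet tends to zero because trajectories merge. The truncation at 1 provides the domination.
  set f : Ω × E → ENNReal := fun p => min (edist p.2 (Z p.1)) 1 with hf
  have hfm : Measurable f :=
    (measurable_snd.edist (hZ.comp measurable_fst)).min measurable_const
  have hconst : ∀ n, ∫⁻ p, f (F^[n] p) ∂Q = ∫⁻ p, f p ∂Q := fun n =>
    (hFm.iterate n).lintegral_comp hfm
  have hlim : Tendsto (fun n => ∫⁻ p, f (F^[n] p) ∂Q) atTop (𝓝 (∫⁻ _, 0 ∂Q)) := by
    refine tendsto_lintegral_of_dominated_convergence (fun _ => 1)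
      (fun n => hfm.comp (hFm.iterate n).measurable)
      (fun n => Eventually.of_forall fun p => min_le_right _ _) (by simp) ?_
    filter_upwards [hfst.quasiMeasurePreserving.ae hctr,
      hfst.quasiMeasurePreserving.ae (ae_eq_cocycle hθ.toMeasurePreserving hZst)] with p h1 h2
    have hd : Tendsto (fun n => ENNReal.ofReal
        (dist (cocycle θ g n p.1 p.2) (cocycle θ g n p.1 (Z p.1)))) atTop (𝓝 0) := by
      rw [← ENNReal.ofReal_zero]
      refine (ENNReal.continuous_ofReal.tendsto 0).comp (Metric.tendsto_atTop.2 fun ε hε => ?_)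
      obtain ⟨n₀, hn₀⟩ := h1 (ε / 2) (by positivity)
      refine ⟨n₀, fun n hn => ?_⟩
      rw [Real.dist_0_eq_abs, abs_of_nonneg dist_nonneg]
      linarith [hn₀ n hn p.2 (Z p.1)]
    refine tendsto_of_tendsto_of_tendsto_of_le_of_le tendsto_const_nhds hd
      (fun _ => zero_le) fun n => ?_
    simp only [hf, hFn]
    rw [h2 n, edist_dist]
    exact min_le_left _ _
  simp only [hconst, lintegral_zero] at hlim
  have h0 : ∫⁻ p, f p ∂Q = 0 := tendsto_nhds_unique tendsto_const_nhds hlim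
  have hgraph : (fun p : Ω × E => (p.1, Z p.1)) =ᵐ[Q] id := by
    filter_upwards [(lintegral_eq_zero_iff hfm).1 h0] with p hp
    have hp' : edist p.2 (Z p.1) = 0 := by
      rcases min_eq_iff.1 (show min (edist p.2 (Z p.1)) 1 = 0 from hp) with h | h
      · exact h.1
      · exact absurd h.1 one_ne_zero
    exact Prod.ext rfl (edist_eq_zero.1 hp').symm
  have hZm : Measurable fun ω => (ω, Z ω) := measurable_id.prodMk hZ
  rw [← hQ1, Measure.map_map hZm measurable_fst]
  exact (Measure.map_id.symm.trans (Measure.map_congr hgraph).symm)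

/-- Stationary regimes of a contracting cocycle are almost surely unique. -/
theorem stationary_ae_unique (hθ : Ergodic θ P)
    (hctr : ∀ᵐ ω ∂P, ∀ η : ℝ, 0 < η → ∃ n₀, ∀ n ≥ n₀, ∀ z z',
      dist (cocycle θ g n ω z) (cocycle θ g n ω z') ≤ η)
    (hg : Measurable (Function.uncurry g))
    {Z Z' : Ω → E} (hZ : Measurable Z) (hZst : ∀ᵐ ω ∂P, Z (θ ω) = g ω (Z ω))
    (hZ' : Measurable Z') (hZst' : ∀ᵐ ω ∂P, Z' (θ ω) = g ω (Z' ω)) : Z' =ᵐ[P] Z := by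
  have hZm' : Measurable fun ω => (ω, Z' ω) := measurable_id.prodMk hZ'
  have hinv := map_graph_invariant hθ.toMeasurePreserving hZ' hZst'
    ((θ.measurable.comp measurable_fst).prodMk hg).aemeasurable
  have hfst : (P.map fun ω => (ω, Z' ω)).map Prod.fst = P := by
    rw [Measure.map_map measurable_fst hZm']
    exact Measure.map_id
  -- The law carried by the graph of `Z'` is invariant, hence carried by the graph of `Z` as well.
  have heq := invariant_eq_map_graph hθ hg hctr hZ hZst hfst hinv
  have hS : MeasurableSet {p : Ω × E | p.2 = Z p.1} :=
    measurableSet_eq_fun measurable_snd (hZ.comp measurable_fst)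
  have hmem : ∀ᵐ p ∂(P.map fun ω => (ω, Z' ω)), p.2 = Z p.1 := by
    rw [heq]
    exact (ae_map_iff (measurable_id.prodMk hZ).aemeasurable hS).2 (Eventually.of_forall fun _ => rfl)
  exact (ae_map_iff hZm'.aemeasurable hS).1 hmem


end Cocycle

/-! ### Measurability in the (max,+) semiring -/

section Measurability

variable {α : Type*} {m : MeasurableSpace α}

theorem measurable_coe_rmax : Measurable fun r : ℝ => (r : Rmax) := fun _ hs => hs

theorem measurable_unbotD : Measurable fun x : Rmax => x.unbotD 0 := by
  intro s hs
  change MeasurableSet ((fun r : ℝ => (r : Rmax)) ⁻¹' ((fun x : Rmax => x.unbotD 0) ⁻¹' s))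
  rwa [← Set.preimage_comp]

theorem measurableSet_eq_bot : MeasurableSet {x : Rmax | x = ⊥} := by
  change MeasurableSet ((fun r : ℝ => (r : Rmax)) ⁻¹' {x : Rmax | x = ⊥})
  simp

/-- The alternatives for `⊥`, absorbing or neutral, cover both `+` and `⊔`. -/
theorem measurable_rmax_binary {f g : α → Rmax} (hf : Measurable f) (hg : Measurable g)
    {op : Rmax → Rmax → Rmax} {h : ℝ → ℝ → ℝ} (hh : Measurable fun p : ℝ × ℝ => h p.1 p.2)
    (hop : ∀ a b : ℝ, op a b = (h a b : ℝ)) (hl : (∀ x, op ⊥ x = ⊥) ∨ ∀ x, op ⊥ x = x)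
    (hr : (∀ x, op x ⊥ = ⊥) ∨ ∀ x, op x ⊥ = x) : Measurable fun a => op (f a) (g a) := by
  classical
  have e : (fun a => op (f a) (g a)) = fun a => if f a = ⊥ then op ⊥ (g a) else
      if g a = ⊥ then op (f a) ⊥ else ((h ((f a).unbotD 0) ((g a).unbotD 0) : ℝ) : Rmax) := by
    funext a
    by_cases h1 : f a = ⊥
    · simp [h1]
    by_cases h2 : g a = ⊥
    · simp only [h1, h2, if_true, if_false]
    obtain ⟨x, hx⟩ := WithBot.ne_bot_iff_exists.1 h1
    obtain ⟨y, hy⟩ := WithBot.ne_bot_iff_exists.1 h2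
    simp [← hx, ← hy, hop]
  rw [e]
  refine Measurable.ite (hf measurableSet_eq_bot) ?_ (Measurable.ite (hg measurableSet_eq_bot) ?_ ?_)
  · rcases hl with hl | hl <;> simp only [hl]
    · exact measurable_const
    · exact hg
  · rcases hr with hr | hr <;> simp only [hr]
    · exact measurable_const
    · exact hf
  · exact measurable_coe_rmax.comp
      (hh.comp ((measurable_unbotD.comp hf).prodMk (measurable_unbotD.comp hg)))

theorem measurable_rmax_add {f g : α → Rmax} (hf : Measurable f) (hg : Measurable g) :
    Measurable fun a => f a + g a :=
  measurable_rmax_binary hf hg (h := fun x y => x + y) (measurable_fst.add measurable_snd)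
    (fun _ _ => (WithBot.coe_add _ _).symm) (Or.inl WithBot.bot_add) (Or.inl WithBot.add_bot)

theorem measurable_rmax_finset_sup {ι : Type*} (s : Finset ι) {f : ι → α → Rmax}
    (hf : ∀ i, Measurable (f i)) : Measurable fun a => s.sup fun i => f i a := by
  classical
  induction s using Finset.induction_on with
  | empty => simp
  | insert i s _ ih =>
    simp only [Finset.sup_insert]
    exact measurable_rmax_binary (hf i) ih (op := fun x y => x ⊔ y) (h := fun x y => x ⊔ y)
      (measurable_fst.sup measurable_snd) (fun _ _ => rfl) (Or.inr bot_sup_eq) (Or.inr sup_bot_eq)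

theorem measurable_mulVec {M : α → Mat k} {x : α → Fin k → Rmax} (hM : Measurable M)
    (hx : Measurable x) : Measurable fun a => mulVec (M a) (x a) :=
  measurable_pi_lambda _ fun i => measurable_rmax_finset_sup _ fun j =>
    measurable_rmax_add ((measurable_pi_apply j).comp ((measurable_pi_apply i).comp hM))
      ((measurable_pi_apply j).comp hx)

theorem measurable_mul {M N : α → Mat k} (hM : Measurable M) (hN : Measurable N) :
    Measurable fun a => mul (M a) (N a) :=
  measurable_pi_lambda _ fun i => measurable_pi_lambda _ fun j =>
    measurable_rmax_finset_sup _ fun l =>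
      measurable_rmax_add ((measurable_pi_apply l).comp ((measurable_pi_apply i).comp hM))
        ((measurable_pi_apply j).comp ((measurable_pi_apply l).comp hN))

theorem measurable_prodMat {Ω : Type*} {m : MeasurableSpace Ω} {A : ℕ → Ω → Mat k} (n : ℕ)
    (hA : ∀ i < n, Measurable (A i)) : Measurable fun ω => prodMat A ω n := by
  induction n with
  | zero => exact measurable_const
  | succ n ih => exact measurable_mul (hA n n.lt_succ_self) (ih fun i hi => hA i (by omega))

theorem measurable_toRmax {u : α → Fin k → ℝ} (hu : Measurable u) :
    Measurable fun a => toRmax (u a) :=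
  measurable_pi_lambda _ fun i => measurable_coe_rmax.comp ((measurable_pi_apply i).comp hu)

theorem measurable_sol {Ω : Type*} {m : MeasurableSpace Ω} {A : ℕ → Ω → Mat k}
    (hA : ∀ i, Measurable (A i)) (x₀ : Fin k → ℝ) (n : ℕ) : Measurable (sol A x₀ n) := by
  induction n with
  | zero => exact measurable_const
  | succ n ih => exact measurable_mulVec (hA n) ih

theorem measurableSet_ball (C : Mat k) (η : ℝ) : MeasurableSet (ball C η) := by
  have : ball C η = ⋂ i, ⋂ j, (fun N : Mat k => N i j) ⁻¹' {x : Rmax | (C i j = ⊥ ∧ x = ⊥) ∨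
      ∃ a b : ℝ, C i j = (a : Rmax) ∧ x = (b : Rmax) ∧ |b - a| < η} := by
    ext N; simp [ball]
  rw [this]
  refine MeasurableSet.iInter fun i => MeasurableSet.iInter fun j =>
    ((measurable_pi_apply j).comp (measurable_pi_apply i)) ?_
  change MeasurableSet ((fun r : ℝ => (r : Rmax)) ⁻¹' _)
  rcases eq_or_ne (C i j) ⊥ with h | h
  · simp [h]
  · obtain ⟨a, ha⟩ := WithBot.ne_bot_iff_exists.1 h
    have : ((fun r : ℝ => (r : Rmax)) ⁻¹' {x : Rmax | (C i j = ⊥ ∧ x = ⊥) ∨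
        ∃ a b : ℝ, C i j = (a : Rmax) ∧ x = (b : Rmax) ∧ |b - a| < η}) = {b | |b - a| < η} := by
      ext b; simp [← ha]
    rw [this]
    exact measurableSet_lt (by fun_prop) measurable_const

end Measurability

/-! ### Neighbourhoods of matrices -/

/-- `x` and `y` are both `-∞`, or real and at distance less than `η`. -/
def Near (η : ℝ) (x y : Rmax) : Prop :=
  (x = ⊥ ∧ y = ⊥) ∨ ∃ a b : ℝ, x = (a : Rmax) ∧ y = (b : Rmax) ∧ |b - a| < η

theorem Near.add {η η' : ℝ} {x y x' y' : Rmax} (h : Near η x y) (h' : Near η' x' y') :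
    Near (η + η') (x + x') (y + y') := by
  rcases h with ⟨rfl, rfl⟩ | ⟨a, b, rfl, rfl, h⟩
  · exact Or.inl ⟨WithBot.bot_add _, WithBot.bot_add _⟩
  rcases h' with ⟨rfl, rfl⟩ | ⟨a', b', rfl, rfl, h'⟩
  · exact Or.inl ⟨WithBot.add_bot _, WithBot.add_bot _⟩
  refine Or.inr ⟨a + a', b + b', (WithBot.coe_add _ _).symm, (WithBot.coe_add _ _).symm, ?_⟩
  rw [abs_lt] at *
  constructor <;> linarith

theorem Near.sup {η : ℝ} {x y x' y' : Rmax} (h : Near η x y) (h' : Near η x' y') :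
    Near η (x ⊔ x') (y ⊔ y') := by
  rcases h with ⟨rfl, rfl⟩ | ⟨a, b, rfl, rfl, h⟩
  · simpa using h'
  rcases h' with ⟨rfl, rfl⟩ | ⟨a', b', rfl, rfl, h'⟩
  · exact Or.inr ⟨a, b, by simp, by simp, h⟩
  refine Or.inr ⟨max a a', max b b', rfl, rfl, ?_⟩
  exact (abs_max_sub_max_le_max b b' a a').trans_lt (max_lt h h')

/-- Errors add under `+` and do not grow under `⊔`. -/
theorem mul_mem_ball {A B M N : Mat k} {η η' : ℝ} (hM : M ∈ ball A η) (hN : N ∈ ball B η') :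
    mul M N ∈ ball (mul A B) (η + η') := by
  intro i j
  change Near (η + η') (Finset.univ.sup _) (Finset.univ.sup _)
  generalize (Finset.univ : Finset (Fin k)) = s
  induction s using Finset.induction_on with
  | empty => exact Or.inl ⟨rfl, rfl⟩
  | insert l s _ ih =>
    rw [Finset.sup_insert, Finset.sup_insert]
    exact (Near.add (hM i l) (hN l j)).sup ih

theorem Near.le {η : ℝ} {x y : Rmax} (h : Near η x y) : y ≤ x + (η : Rmax) := by
  rcases h with ⟨rfl, rfl⟩ | ⟨a, b, rfl, rfl, h⟩
  · exact bot_le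
  · rw [← WithBot.coe_add, WithBot.coe_le_coe]
    linarith [(abs_lt.1 h).2]

theorem Near.symm {η : ℝ} {x y : Rmax} (h : Near η x y) : Near η y x := by
  rcases h with ⟨rfl, rfl⟩ | ⟨a, b, rfl, rfl, h⟩
  · exact Or.inl ⟨rfl, rfl⟩
  · exact Or.inr ⟨b, a, rfl, rfl, by rwa [abs_sub_comm]⟩

section Projective

/-! ### The projective space -/

theorem proj_surjective (z : PR k) : ∃ u, proj u = z := Quotient.exists_rep z

theorem dist_proj (u v : Fin k → ℝ) : dist (proj u) (proj v) = projDist u v := rfl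

theorem projDist_le [Nonempty (Fin k)] {u v : Fin k → ℝ} {a b : ℝ} (h : ∀ i, u i - v i ≤ a)
    (h' : ∀ i, v i - u i ≤ b) : projDist u v ≤ a + b :=
  add_le_add (ciSup_le h) (ciSup_le h')

/-- The representative with maximum `0` of a projective point. -/
noncomputable def sec [Nonempty (Fin k)] : PR k → Fin k → ℝ :=
  Quotient.lift (fun u i => u i - ⨆ j, u j) (by
    rintro u v ⟨a, h⟩
    funext i
    have : (⨆ j, u j) = a + ⨆ j, v j := by
      rw [← iSup_const_add a v (Fin.pos_iff_nonempty.2 ‹_›)]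
      exact iSup_congr h
    simp only [this, h i]
    ring)

variable [Nonempty (Fin k)]

theorem proj_sec (z : PR k) : proj (sec z) = z := by
  obtain ⟨u, rfl⟩ := proj_surjective z
  exact Quotient.sound ⟨-⨆ j, u j, fun i => by simp [sec, proj]; ring⟩

theorem sec_sub_le (u v : Fin k → ℝ) (i : Fin k) :
    sec (proj u) i - sec (proj v) i ≤ projDist u v := by
  change (u i - ⨆ j, u j) - (v i - ⨆ j, v j) ≤ _
  have h1 := le_iSup_fin (fun i => u i - v i) i
  have h2 : (⨆ j, v j) ≤ (⨆ j, u j) + ⨆ j, (v j - u j) := ciSup_le fun j => by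
    have e1 := le_iSup_fin u j
    have e2 := le_iSup_fin (fun i => v i - u i) j
    linarith
  unfold projDist
  linarith

/-- This Lipschitz section transfers completeness from ℝ^k to `PR k` and makes `secAct` measurable.
-/
theorem lipschitzWith_sec : LipschitzWith 1 (sec (k := k)) := by
  refine LipschitzWith.of_dist_le_mul fun z z' => ?_
  obtain ⟨u, rfl⟩ := proj_surjective z
  obtain ⟨v, rfl⟩ := proj_surjective z'
  rw [NNReal.coe_one, _root_.one_mul, dist_pi_le_iff dist_nonneg]
  intro i
  rw [Real.dist_eq, abs_le]
  have h1 := sec_sub_le u v i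
  have h2 := sec_sub_le v u i
  rw [← dist_proj] at h1 h2
  rw [dist_comm] at h2
  constructor <;> linarith

theorem lipschitzWith_proj : LipschitzWith 2 (proj (k := k)) := by
  refine LipschitzWith.of_dist_le_mul fun u v => ?_
  have h : ∀ i, |u i - v i| ≤ dist u v := fun i => dist_le_pi_dist u v i
  have := projDist_le (u := u) (v := v) (fun i => (le_abs_self _).trans (h i))
    (fun i => by rw [← neg_sub]; exact (neg_le_abs _).trans (h i))
  rw [dist_proj]
  push_cast
  linarith

instance : Nonempty (PR k) := ⟨proj 0⟩

instance : SecondCountableTopology (PR k) := by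
  have : TopologicalSpace.SeparableSpace (PR k) :=
    DenseRange.separableSpace (f := proj (k := k)) (Function.Surjective.denseRange proj_surjective)
      lipschitzWith_proj.continuous
  exact UniformSpace.secondCountable_of_separable _

instance : CompleteSpace (PR k) := by
  refine Metric.complete_of_cauchySeq_tendsto fun z hz => ?_
  obtain ⟨u, hu⟩ := cauchySeq_tendsto_of_complete
    (lipschitzWith_sec.uniformContinuous.comp_cauchySeq hz)
  refine ⟨proj u, ?_⟩
  simpa [Function.comp_def, proj_sec] using (lipschitzWith_proj.continuous.tendsto u).comp hu

/-! ### The projective action -/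

omit [Nonempty (Fin k)] in
theorem projR_toRmax (u : Fin k → ℝ) : projR (toRmax u) = proj u := by simp [projR, toRmax]

/-- Every row has a real entry. -/
def RowRegular (A : Mat k) : Prop := ∀ i, ∃ j, A i j ≠ ⊥

omit [Nonempty (Fin k)] in
theorem RowRegular.exists_mulVec {A : Mat k} (hA : RowRegular A) (u : Fin k → ℝ) :
    ∃ y : Fin k → ℝ, mulVec A (toRmax u) = toRmax y := by
  have : ∀ i, ∃ y : ℝ, mulVec A (toRmax u) i = y := by
    intro i
    obtain ⟨j, hj⟩ := hA i
    obtain ⟨r, hr⟩ := WithBot.ne_bot_iff_exists.1 hj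
    have h := le_mulVec A (toRmax u) i j
    rw [toRmax, ← hr, ← WithBot.coe_add] at h
    exact ⟨_, (WithBot.coe_unbot _ ((WithBot.bot_lt_coe _).trans_le h).ne').symm⟩
  choose y hy using this
  exact ⟨y, funext hy⟩

omit [Nonempty (Fin k)] in
theorem mulVec_toRmax_sub_le {A : Mat k} {u v y y' : Fin k → ℝ} {a : ℝ}
    (hu : mulVec A (toRmax u) = toRmax y) (hv : mulVec A (toRmax v) = toRmax y')
    (h : ∀ i, u i - v i ≤ a) (i : Fin k) : y i - y' i ≤ a := by
  have key : mulVec A (toRmax u) i ≤ mulVec A (toRmax v) i + (a : Rmax) := by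
    refine mulVec_le fun j => ?_
    refine le_trans ?_ (add_le_add (le_mulVec A (toRmax v) i j) le_rfl)
    rw [add_assoc]
    refine add_le_add le_rfl ?_
    rw [toRmax, toRmax, ← WithBot.coe_add, WithBot.coe_le_coe]
    linarith [h j]
  rw [hu, hv, toRmax, toRmax, ← WithBot.coe_add, WithBot.coe_le_coe] at key
  linarith

/-- The product is monotone and commutes with adding constants, so neither of the two maxima in the
distance can grow. -/
theorem dist_projR_mulVec_le {A : Mat k} (hA : RowRegular A) (u v : Fin k → ℝ) :
    dist (projR (mulVec A (toRmax u))) (projR (mulVec A (toRmax v))) ≤ dist (proj u) (proj v) := by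
  obtain ⟨y, hy⟩ := hA.exists_mulVec u
  obtain ⟨y', hy'⟩ := hA.exists_mulVec v
  rw [hy, hy', projR_toRmax, projR_toRmax]
  exact projDist_le (mulVec_toRmax_sub_le hy hy' fun i => le_iSup_fin (fun i => u i - v i) i)
    (mulVec_toRmax_sub_le hy' hy fun i => le_iSup_fin (fun i => v i - u i) i)

/-- The projective action, read in the representatives `sec`; unlike `act`, it is measurable. -/
noncomputable def secAct (A : Mat k) (z : PR k) : PR k := projR (mulVec A (toRmax (sec z)))

theorem RowRegular.projR_mulVec_congr {A : Mat k} (hA : RowRegular A) {u v : Fin k → ℝ}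
    (h : proj u = proj v) : projR (mulVec A (toRmax u)) = projR (mulVec A (toRmax v)) := by
  have := dist_projR_mulVec_le hA u v
  rw [h, dist_self] at this
  exact dist_le_zero.1 this

theorem RowRegular.secAct_proj {A : Mat k} (hA : RowRegular A) (u : Fin k → ℝ) :
    secAct A (proj u) = projR (mulVec A (toRmax u)) :=
  hA.projR_mulVec_congr (proj_sec _)

theorem RowRegular.act_eq {A : Mat k} (hA : RowRegular A) (z : PR k) : act A z = secAct A z :=
  hA.projR_mulVec_congr ((Quotient.out_eq z).trans (proj_sec z).symm)

theorem RowRegular.dist_secAct_le {A : Mat k} (hA : RowRegular A) (z z' : PR k) :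
    dist (secAct A z) (secAct A z') ≤ dist z z' := by
  have h := dist_projR_mulVec_le hA (sec z) (sec z')
  rwa [proj_sec, proj_sec] at h

theorem secAct_one (z : PR k) : secAct one z = z := by
  rw [secAct, mulVec_one, projR_toRmax, proj_sec]

theorem secAct_mul {A B : Mat k} (hA : RowRegular A) (hB : RowRegular B) (z : PR k) :
    secAct (mul A B) z = secAct A (secAct B z) := by
  obtain ⟨y, hy⟩ := hB.exists_mulVec (sec z)
  rw [secAct, mulVec_mul, secAct.eq_1 B, hy, projR_toRmax, hA.secAct_proj]

omit [Nonempty (Fin k)] in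
theorem RowRegular.mul {A B : Mat k} (hA : RowRegular A) (hB : RowRegular B) :
    RowRegular (mul A B) := by
  intro i
  obtain ⟨l, hl⟩ := hA i
  obtain ⟨j, hj⟩ := hB l
  refine ⟨j, fun h => ?_⟩
  have h1 := le_mul A B i l j
  rw [h, le_bot_iff, WithBot.add_eq_bot] at h1
  exact h1.elim hl hj

omit [Nonempty (Fin k)] in
theorem rowRegular_one : RowRegular (one : Mat k) := fun i => ⟨i, by simp [one]⟩

theorem measurable_projR : Measurable (projR (k := k)) :=
  lipschitzWith_proj.continuous.measurable.comp
    (measurable_pi_lambda _ fun i => measurable_unbotD.comp (measurable_pi_apply i))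

theorem measurable_secAct : Measurable fun p : Mat k × PR k => secAct p.1 p.2 :=
  measurable_projR.comp (measurable_mulVec measurable_fst
    (measurable_toRmax (lipschitzWith_sec.continuous.measurable.comp measurable_snd)))

omit [Nonempty (Fin k)] in
theorem rowRegular_of_mem_ball {D M : Mat k} {δ : ℝ} (hM : M ∈ ball D δ) (h : RowRegular M) :
    RowRegular D := by
  intro i
  obtain ⟨j, hj⟩ := h i
  refine ⟨j, fun hb => ?_⟩
  rcases hM i j with h1 | ⟨a, b, h1, -⟩
  · exact hj h1.2
  · simp [hb] at h1

omit [Nonempty (Fin k)] in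
theorem mulVec_le_of_mem_ball {D M : Mat k} {δ : ℝ} (hM : ∀ i j, M i j ≤ D i j + (δ : Rmax))
    (x : Fin k → Rmax) (i : Fin k) : mulVec M x i ≤ mulVec D x i + (δ : Rmax) := by
  refine mulVec_le fun j => (add_le_add (hM i j) le_rfl).trans ?_
  rw [add_right_comm]
  exact add_le_add (le_mulVec D x i j) le_rfl

/-- Near a matrix of the form `w i + α j`, the projective action has a small range. -/
theorem dist_secAct_le_of_mem_ball {D M : Mat k} (hD : IsOuter D) {δ : ℝ} (hM : M ∈ ball D δ)
    (hreg : RowRegular M) (z z' : PR k) : dist (secAct M z) (secAct M z') ≤ 4 * δ := by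
  obtain ⟨w, α, hwα⟩ := hD
  -- A matrix in a ball has the same `-∞` entries as the centre; regularity of `D` then makes `w`
  -- real.
  have hDreg := rowRegular_of_mem_ball hM hreg
  have hw : ∀ i, ∃ r : ℝ, w i = r := by
    intro i
    obtain ⟨j, hj⟩ := hDreg i
    rw [hwα, Ne, WithBot.add_eq_bot, not_or] at hj
    exact ⟨_, (WithBot.coe_unbot _ hj.1).symm⟩
  choose w' hw' using hw
  have key : ∀ u : Fin k → ℝ, ∃ (s : ℝ) (y : Fin k → ℝ), mulVec M (toRmax u) = toRmax y ∧
      ∀ i, y i ≤ w' i + s + δ ∧ w' i + s ≤ y i + δ := by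
    intro u
    obtain ⟨y, hy⟩ := hreg.exists_mulVec u
    obtain ⟨y', hy'⟩ := hDreg.exists_mulVec u
    have hup : ∀ i, mulVec M (toRmax u) i ≤ mulVec D (toRmax u) i + (δ : Rmax) :=
      mulVec_le_of_mem_ball (fun i j => Near.le (hM i j)) _
    have hlo : ∀ i, mulVec D (toRmax u) i ≤ mulVec M (toRmax u) i + (δ : Rmax) :=
      mulVec_le_of_mem_ball (fun i j => Near.le (Near.symm (hM i j))) _
    -- The product of `D` with `u` is `w` shifted by the maximum of `α j + u j`, which does not
    -- depend on the row.
    have hconst : ∀ i i', y' i - w' i ≤ y' i' - w' i' := by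
      intro i i'
      obtain ⟨j, hj⟩ := exists_mulVec_eq D (toRmax u) i
      have h := le_mulVec D (toRmax u) i' j
      rw [hy'] at hj h
      rw [hwα, hw', toRmax, toRmax] at hj h
      have hα : α j ≠ ⊥ := by
        intro hb
        simp [hb] at hj
      obtain ⟨r, hr⟩ := WithBot.ne_bot_iff_exists.1 hα
      rw [← hr, ← WithBot.coe_add, ← WithBot.coe_add] at hj h
      have hj' := WithBot.coe_inj.1 hj
      have h' := WithBot.coe_le_coe.1 h
      linarith
    obtain ⟨i₀⟩ := ‹Nonempty (Fin k)›
    refine ⟨y' i₀ - w' i₀, y, hy, fun i => ?_⟩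
    have e1 := hup i
    have e2 := hlo i
    rw [hy, hy', toRmax, toRmax, ← WithBot.coe_add, WithBot.coe_le_coe] at e1 e2
    have e3 := hconst i i₀
    have e4 := hconst i₀ i
    constructor <;> linarith
  obtain ⟨s, y, hy, h⟩ := key (sec z)
  obtain ⟨s', y', hy', h'⟩ := key (sec z')
  rw [secAct, secAct, hy, hy', projR_toRmax, projR_toRmax, dist_proj]
  -- Each image is within δ of a translate of `w'`; the shifts `s` and `s'` cancel in the sum.
  refine (projDist_le (a := s - s' + 2 * δ) (b := s' - s + 2 * δ) (fun i => ?_) fun i => ?_).trans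
    (by linarith)
  · linarith [(h i).1, (h' i).2]
  · linarith [(h i).2, (h' i).1]

end Projective

/-! ### Products of the random matrices -/

section Products

variable {Ω : Type u}

theorem eq_comp_iterate {θ : Ω → Ω} {A : ℕ → Ω → Mat k} (hstat : ∀ n, A (n + 1) = A n ∘ θ)
    (m n : ℕ) (ω : Ω) : A (m + n) ω = A m (θ^[n] ω) := by
  induction n generalizing ω with
  | zero => rfl
  | succ n ih =>
    rw [← add_assoc, hstat, Function.comp_apply, ih, Function.iterate_succ_apply]

theorem prodMat_add (A : ℕ → Ω → Mat k) (ω : Ω) (m n : ℕ) :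
    prodMat A ω (m + n) = mul (prodMat (fun i => A (i + n)) ω m) (prodMat A ω n) := by
  induction m with
  | zero => rw [Nat.zero_add]; exact (one_mul _).symm
  | succ m ih =>
    rw [Nat.add_right_comm]
    simp only [prodMat]
    rw [ih, mul_assoc]

theorem prodMat_shift {θ : Ω → Ω} {A : ℕ → Ω → Mat k} (hstat : ∀ n, A (n + 1) = A n ∘ θ)
    (ω : Ω) (m n : ℕ) : prodMat (fun i => A (i + n)) ω m = prodMat A (θ^[n] ω) m := by
  induction m with
  | zero => rfl
  | succ m ih =>
    simp only [prodMat]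
    rw [ih, eq_comp_iterate hstat]

theorem rowRegular_prodMat {A : ℕ → Ω → Mat k} {ω : Ω} (h : ∀ n, RowRegular (A n ω)) (n : ℕ) :
    RowRegular (prodMat A ω n) := by
  induction n with
  | zero => exact rowRegular_one
  | succ n ih => exact (h n).mul ih

theorem secAct_prodMat [Nonempty (Fin k)] {θ : Ω → Ω} {A : ℕ → Ω → Mat k}
    (hstat : ∀ n, A (n + 1) = A n ∘ θ) {ω : Ω} (h : ∀ n, RowRegular (A n ω)) (n : ℕ) (z : PR k) :
    secAct (prodMat A ω n) z = cocycle θ (fun ω z => secAct (A 0 ω) z) n ω z := by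
  induction n with
  | zero => exact secAct_one z
  | succ n ih =>
    simp only [prodMat, cocycle]
    rw [secAct_mul (h n) (rowRegular_prodMat h n), ih, ← eq_comp_iterate hstat, Nat.zero_add]

theorem sol_eq (A : ℕ → Ω → Mat k) (x₀ : Fin k → ℝ) (n : ℕ) (ω : Ω) :
    sol A x₀ n ω = mulVec (prodMat A ω n) (toRmax x₀) := by
  induction n with
  | zero => exact (mulVec_one _).symm
  | succ n ih => simp only [sol, prodMat, ih, mulVec_mul]

variable [MeasurableSpace Ω] {P : Measure Ω}

/-- For independent matrices, the powers of a pattern are patterns. -/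
theorem pow_mem_support [IsProbabilityMeasure P] {θ : Ω → Ω} (hθ : MeasurePreserving θ P P)
    {A : ℕ → Ω → Mat k} (hA : ∀ n, Measurable (A n)) (hstat : ∀ n, A (n + 1) = A n ∘ θ)
    (hind : iIndepFun A P) {C : Mat k} {N : ℕ}
    (hC : ∀ η : ℝ, 0 < η → 0 < P {ω | prodMat A ω N ∈ ball C η}) (m : ℕ) :
    ∀ η : ℝ, 0 < η → 0 < P {ω | prodMat A ω (m * N) ∈ ball (pow C m) η} := by
  induction m with
  | zero =>
    intro η hη
    have : {ω : Ω | prodMat A ω (0 * N) ∈ ball (pow C 0) η} = Set.univ := by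
      refine Set.eq_univ_of_forall fun ω i j => ?_
      rw [Nat.zero_mul]
      by_cases h : i = j
      · exact Or.inr ⟨0, 0, by simp [pow, one, h], by simp [prodMat, one, h], by simpa using hη⟩
      · exact Or.inl ⟨by simp [pow, one, h], by simp [prodMat, one, h]⟩
    rw [this, measure_univ]
    exact one_pos
  | succ m ih =>
    intro η hη
    have h1 := ih (η / 2) (by positivity)
    -- By stationarity the shifted block has the law of the first one.
    have h2 : 0 < P {ω | prodMat (fun i => A (i + m * N)) ω N ∈ ball C (η / 2)} := by
      simp only [prodMat_shift hstat]
      have := (hθ.iterate (m * N)).measure_preimage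
        ((measurable_prodMat N fun i _ => hA i)
          (measurableSet_ball C (η / 2))).nullMeasurableSet
      exact (hC (η / 2) (by positivity)).trans_eq this.symm
    -- The first `m * N` matrices are independent of the later ones, so the two events occur
    -- together with positive probability.
    have hI := indep_iSup_of_disjoint (fun n => (hA n).comap_le)
      ((iIndepFun_iff_iIndep _ _ _).1 hind)
      (S := Set.Iio (m * N)) (T := Set.Ici (m * N))
      (Set.disjoint_left.2 fun i hi hi' => not_lt.2 (Set.mem_Ici.1 hi') (Set.mem_Iio.1 hi))
    have hle : ∀ (T : Set ℕ) (i : ℕ), i ∈ T → Measurable[⨆ i ∈ T, MeasurableSpace.comap (A i)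
        inferInstance] (A i) := fun T i hi =>
      measurable_iff_comap_le.2 (le_iSup₂ (f := fun i (_ : i ∈ T) =>
        MeasurableSpace.comap (A i) inferInstance) i hi)
    have hm1 := measurable_prodMat (A := A) (m * N) (fun i hi => hle (Set.Iio (m * N)) i hi)
      (measurableSet_ball (pow C m) (η / 2))
    have hm2 := measurable_prodMat (A := fun i => A (i + m * N)) N
      (fun i _ => hle (Set.Ici (m * N)) (i + m * N) (Nat.le_add_left _ _))
      (measurableSet_ball C (η / 2))
    have hprod := (Indep_iff _ _ _).1 hI _ _ hm1 hm2
    have hpos := ENNReal.mul_pos h1.ne' h2.ne'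
    refine (hpos.trans_eq hprod.symm).trans_le (measure_mono ?_)
    rintro ω ⟨e1, e2⟩
    have := mul_mem_ball (show _ ∈ ball C (η / 2) from e2) (show _ ∈ ball _ (η / 2) from e1)
    rw [add_halves] at this
    change prodMat A ω ((m + 1) * N) ∈ ball (mul C (pow C m)) η
    rwa [show (m + 1) * N = N + m * N by ring, prodMat_add]

end Products

/-- A random time after which a sequence of distances stays below `η`. -/
theorem exists_measurable_time {Ω : Type*} [MeasurableSpace Ω] {P : Measure Ω} {f : ℕ → Ω → ℝ}
    (hf : ∀ n, Measurable (f n)) {η : ℝ} (h : ∀ᵐ ω ∂P, ∃ n₀, ∀ n ≥ n₀, f n ω ≤ η) :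
    ∃ N : Ω → ℕ, Measurable N ∧ ∀ᵐ ω ∂P, ∀ n, N ω ≤ n → f n ω ≤ η := by
  classical
  have hB : ∀ q, MeasurableSet {ω | ∀ n ≥ q, f n ω ≤ η} := by
    intro q
    simp only [Set.ofPred_forall]
    exact MeasurableSet.iInter fun n => MeasurableSet.iInter fun _ =>
      measurableSet_le (hf n) measurable_const
  have hex : MeasurableSet {ω | ∃ q, ∀ n ≥ q, f n ω ≤ η} := by
    rw [Set.ofPred_exists]
    exact MeasurableSet.iUnion hB
  -- The second alternative makes the search succeed everywhere, with value 0 on the exceptional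
  -- null set.
  let p : Ω → ℕ → Prop := fun ω q => (∀ n ≥ q, f n ω ≤ η) ∨ ¬ ∃ q, ∀ n ≥ q, f n ω ≤ η
  have hp : ∀ ω, ∃ q, p ω q := by
    intro ω
    by_cases h : ∃ q, ∀ n ≥ q, f n ω ≤ η
    · exact h.imp fun q hq => Or.inl hq
    · exact ⟨0, Or.inr h⟩
  refine ⟨fun ω => Nat.find (hp ω), measurable_find hp fun q => (hB q).union hex.compl, ?_⟩
  filter_upwards [h] with ω hω n hn
  rcases Nat.find_spec (hp ω) with h1 | h1
  · exact h1 n hn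
  · exact absurd hω h1

end MaxPlus

/-! ### Assembly of the theorem. -/

theorem mainTheorem5 {Ω : Type u} [MeasurableSpace Ω] (P : Measure Ω) [IsProbabilityMeasure P]
    (θ : Ω ≃ᵐ Ω) (hθ : Ergodic θ P)
    (k : ℕ) (A : ℕ → Ω → MaxPlus.Mat k) (hA : Measurable (A 0))
    (hstat : ∀ n, A (n + 1) = A n ∘ θ)
    (hrow : ∀ᵐ ω ∂P, ∀ i, ∃ j, A 0 ω i j ≠ ⊥)
    (C : MaxPlus.Mat k) (hC : MaxPlus.IsPattern P A C)
    (hcase : (iIndepFun A P ∧ MaxPlus.IsScs1Cyc1 C) ∨ MaxPlus.HasRank C 1) :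
    ∃ Z : Ω → MaxPlus.PR k,
      MaxPlus.IsStationaryRegime P θ A Z ∧
      (∀ Z' : Ω → MaxPlus.PR k, MaxPlus.IsStationaryRegime P θ A Z' → Z' =ᵐ[P] Z) ∧
      (∀ Q : Measure (Ω × MaxPlus.PR k), MaxPlus.IsStationaryDistribution P θ A Q ↔
        Q = P.map fun ω => (ω, Z ω)) ∧
      ∀ x₀ : Fin k → ℝ,
        MaxPlus.EtaCoupling P P (fun n ω => MaxPlus.projR (MaxPlus.sol A x₀ n ω))
          (fun n ω => Z (θ^[n] ω)) ∧
        TendstoInDistribution (fun n ω => MaxPlus.projR (MaxPlus.sol A x₀ n ω)) atTop Z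
          (fun _ => P) P := by
  open MaxPlus in
  have hmp : MeasurePreserving θ P P := hθ.toMeasurePreserving
  have hAθ : ∀ n, A n = A 0 ∘ θ^[n] := fun n => funext fun ω => by
    simpa using eq_comp_iterate hstat 0 n ω
  have hAm : ∀ n, Measurable (A n) := fun n => by
    rw [hAθ]; exact hA.comp (θ.measurable.iterate n)
  -- Both alternatives on `C` exclude `k = 0`.
  have : Nonempty (Fin k) := by
    rcases hcase with ⟨-, h⟩ | ⟨J, hJ, -⟩
    · obtain ⟨i, -⟩ := h.scs1.1
      exact ⟨i⟩
    · obtain ⟨i, -⟩ := Finset.card_eq_one.1 hJ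
      exact ⟨i⟩
  obtain ⟨N, D, hD, hND⟩ : ∃ (N : ℕ) (D : Mat k), IsOuter D ∧
      ∀ η : ℝ, 0 < η → 0 < P {ω | prodMat A ω N ∈ ball D η} := by
    obtain ⟨N, -, hN⟩ := hC
    rcases hcase with ⟨hind, h⟩ | h
    · obtain ⟨m, hm⟩ := h.exists_isOuter_pow
      exact ⟨m * N, _, hm, pow_mem_support hmp hAm hstat hind hN m⟩
    · exact ⟨N, C, h.isOuter, hN⟩
  set g : Ω → PR k → PR k := fun ω z => secAct (A 0 ω) z with hgdef
  have hg : Measurable (Function.uncurry g) :=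
    measurable_secAct.comp ((hA.comp measurable_fst).prodMk measurable_snd)
  have hreg : ∀ᵐ ω ∂P, ∀ n, RowRegular (A n ω) := by
    filter_upwards [ae_iterate hmp hrow] with ω h n
    rw [hAθ]
    exact h n
  have hne : ∀ᵐ ω ∂P, ∀ z z', dist (g ω z) (g ω z') ≤ dist z z' := by
    filter_upwards [hrow] with ω h
    exact RowRegular.dist_secAct_le h
  have hcon : ∀ η : ℝ, 0 < η → ∃ (N : ℕ) (S : Set Ω), MeasurableSet S ∧ 0 < P S ∧
      ∀ᵐ ω ∂P, ω ∈ S → ∀ z z', dist (cocycle θ g N ω z) (cocycle θ g N ω z') ≤ η := by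
    intro η hη
    refine ⟨N, {ω | prodMat A ω N ∈ ball D (η / 4)},
      (measurable_prodMat N fun i _ => hAm i) (measurableSet_ball D (η / 4)),
      hND _ (by positivity), ?_⟩
    filter_upwards [hreg] with ω hω hS z z'
    rw [← secAct_prodMat hstat hω, ← secAct_prodMat hstat hω]
    exact (dist_secAct_le_of_mem_ball hD hS (rowRegular_prodMat hω N) z z').trans (by linarith)
  have hctr := ae_forall_exists_dist_cocycle_le hθ hne hcon
  obtain ⟨Z, hZ, hZst, hZlim⟩ := exists_tendsto_pullback hθ hg hne hcon
  have hact : ∀ᵐ ω ∂P, ∀ z, act (A 0 ω) z = g ω z := by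
    filter_upwards [hrow] with ω h
    exact RowRegular.act_eq h
  have hZm : Measurable fun ω => (ω, Z ω) := measurable_id.prodMk hZ
  -- `act` relies on chosen representatives, and `Measure.map` is 0 for a map that is not a.e.
  -- measurable. Under first marginal `P` the skew product agrees a.e. with the measurable one built
  -- from `g`.
  have hF : ∀ {Q : Measure (Ω × PR k)}, Q.map Prod.fst = P →
      (fun p : Ω × PR k => (θ p.1, g p.1 p.2)) =ᵐ[Q] fun p => (θ p.1, act (A 0 p.1) p.2) := by
    intro Q hQ
    have hfst : MeasurePreserving (Prod.fst : Ω × PR k → Ω) Q P := ⟨measurable_fst, hQ⟩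
    filter_upwards [hfst.quasiMeasurePreserving.ae hact] with p hp
    rw [hp]
  refine ⟨Z, ⟨hZ, ?_⟩, fun Z' hZ' => ?_, fun Q => ⟨fun hQ => ?_, ?_⟩, fun x₀ => ?_⟩
  · filter_upwards [hZst, hact] with ω h1 h2
    rw [h1, h2]
  · refine stationary_ae_unique hθ hctr hg hZ hZst hZ'.1 ?_
    filter_upwards [hZ'.2, hact] with ω h1 h2
    rw [h1, h2]
  · refine invariant_eq_map_graph hθ hg hctr hZ hZst hQ.1 ?_
    rw [Measure.map_congr (hF hQ.1)]
    exact hQ.2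
  · rintro rfl
    have hfst : (P.map fun ω => (ω, Z ω)).map Prod.fst = P := by
      rw [Measure.map_map measurable_fst hZm]
      exact Measure.map_id
    refine ⟨hfst, ?_⟩
    rw [← Measure.map_congr (hF hfst)]
    exact map_graph_invariant hmp hZ hZst ((θ.measurable.comp measurable_fst).prodMk hg).aemeasurable
  · have hXm : ∀ n, Measurable fun ω => projR (sol A x₀ n ω) := fun n =>
      measurable_projR.comp (measurable_sol hAm x₀ n)
    have hX : ∀ᵐ ω ∂P, ∀ n, projR (sol A x₀ n ω) = cocycle θ g n ω (proj x₀) := by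
      filter_upwards [hreg] with ω hω n
      rw [← secAct_prodMat hstat hω, (rowRegular_prodMat hω n).secAct_proj, sol_eq]
    have hYm : ∀ n, Measurable fun ω => Z (θ^[n] ω) := fun n =>
      hZ.comp (θ.measurable.iterate n)
    refine ⟨fun η hη => ?_, fun n => (hXm n).aemeasurable, hZ.aemeasurable, ?_⟩
    · obtain ⟨T, hT, hTle⟩ := exists_measurable_time (P := P) (η := η)
        (fun n => (hXm n).dist (hYm n)) (by
          filter_upwards [hX, ae_eq_cocycle hmp hZst, hctr] with ω h1 h2 h3
          obtain ⟨n₀, hn₀⟩ := h3 η hη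
          refine ⟨n₀, fun n hn => ?_⟩
          rw [h1, h2]
          exact hn₀ n hn _ _)
      -- No new versions are needed: the two sequences already couple on `Ω`.
      exact ⟨Ω, inferInstance, P, _, _, T, inferInstance,
        IdentDistrib.refl (measurable_pi_lambda _ hXm).aemeasurable,
        IdentDistrib.refl (measurable_pi_lambda _ hYm).aemeasurable, hT, hTle⟩
    · refine ProbabilityMeasure.tendsto_iff_forall_integral_tendsto.2 fun f => ?_
      have hpm : ∀ n, Measurable fun ω => pullback θ g n ω (proj x₀) := fun n =>
        (measurable_cocycle θ.measurable hg n).comp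
          ((θ.symm.measurable.iterate n).prodMk measurable_const)
      have hlaw : ∀ n, ∫ z, f z ∂(P.map fun ω => projR (sol A x₀ n ω)) =
          ∫ ω, f (pullback θ g n ω (proj x₀)) ∂P := by
        intro n
        have hcm : Measurable fun ω => cocycle θ g n ω (proj x₀) :=
          (measurable_cocycle θ.measurable hg n).comp (measurable_id.prodMk measurable_const)
        -- Invariance of `P` under the inverse shift equates the laws of the forward and backward
        -- iterates; the backward ones converge almost surely.
        have e : P.map (fun ω => projR (sol A x₀ n ω)) =
            P.map fun ω => pullback θ g n ω (proj x₀) := by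
          rw [Measure.map_congr (hX.mono fun ω h => h n),
            ← (hθ.symm.toMeasurePreserving.iterate n).map_eq,
            Measure.map_map hcm (θ.symm.measurable.iterate n),
            (hθ.symm.toMeasurePreserving.iterate n).map_eq]
          rfl
        rw [e, integral_map (hpm n).aemeasurable f.continuous.measurable.aestronglyMeasurable]
      have hlim : Tendsto (fun n => ∫ ω, f (pullback θ g n ω (proj x₀)) ∂P) atTop
          (𝓝 (∫ ω, f (Z ω) ∂P)) := by
        refine tendsto_integral_of_dominated_convergence (fun _ => ‖f‖)
          (fun n => (f.continuous.measurable.comp (hpm n)).aestronglyMeasurable)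
          (integrable_const _)
          (fun n => Eventually.of_forall fun ω => f.norm_coe_le_norm _) ?_
        filter_upwards [hZlim (proj x₀)] with ω hω
        exact (f.continuous.tendsto _).comp hω
      change Tendsto (fun n => ∫ z, f z ∂(P.map fun ω => projR (sol A x₀ n ω))) atTop
        (𝓝 (∫ z, f z ∂(P.map Z)))
      simp only [hlaw]
      rwa [integral_map hZ.aemeasurable f.continuous.measurable.aestronglyMeasurable]
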